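/- Let $N\ge 0$ and let $\omega:[0,\infty)\to[0,\infty)$ be a non-quasianalytic weight function, i.e. $\omega$ is continuous and increasing, there is $K\ge 1$ with $\omega(2t)\le K(1+\omega(t))$ for all $t\ge 0$, $\int_1^\infty \frac{\omega(t)}{1+t^2}\,dt<\infty$, there are $a\in\mathbb R$, $b>0$ with $\omega(t)\ge a+b\log(1+t)$ for all $t\ge0$, and $\varphi_\omega(t):=\omega(e^t)$ is convex. Put $\omega(x):=\omega(|x|)$ for $x\in\mathbb R^N$, and let $\varphi^*_\omega(s):=\sup_{t\ge 0}\{st-\varphi_\omega(t)\}\in(-\infty,\infty]$ for $s\ge 0$, with the convention $e^{-\infty}=0$. Let $\mathcal S_\omega(\mathbb R^N)$ be the set of all $f\in L^1(\mathbb R^N)$ such that $f,\hat f\in C^\infty(\mathbb R^N)$ and $\|e^{\lambda\omega}\partial^\alpha f\|_\infty<\infty$, $\|e^{\lambda\omega}\partial^\alpha \hat f\|_\infty<\infty$ for all $\lambda>0$ and $\alpha\in\mathbb N_0^N$, where $\hat f(\xi)=\int f(x)e^{-ix\cdot\xi}\,dx$. For integers $m,n\ge 1$ let $\mathcal O^m_{n,\omega}(\mathbb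 R^N)$ be the space of all $f\in C^\infty(\mathbb R^N)$ with $$r_{m,n}(f):=\sup_{\alpha}\sup_{x}|\partial^\alpha f(x)|\exp\Bigl(-n\omega(x)-m\varphi^*_\omega\bigl(\tfrac{|\alpha|}{m}\bigr)\Bigr)<\infty ,$$ normed by $r_{m,n}$, and endow $\bigcup_{n\ge1}\mathcal O^m_{n,\omega}(\mathbb R^N)$ with the locally convex inductive limit topology (the finest locally convex topology making all inclusions $\mathcal O^m_{n,\omega}(\mathbb R^N)\hookrightarrow\bigcup_{n\ge1}\mathcal O^m_{n,\omega}(\mathbb R^N)$ continuous). Let $\mathcal O^m_{s_\omega}(\mathbb R^N)$ be the space of all $f\in C^\infty(\mathbb R^N)$ such that $$q_{m,g}(f):=\sup_{\alpha}\sup_{x}|g(x)|\,|\partial^\alpha f(x)|\exp\Bigl(-m\varphi^*_\omega\bigl(\tfrac{|\alpha|}{m}\bigr)\Bigr)<\infty\quad\text{for all } g\in\mathcal S_\omega(\mathbb R^N),$$ endowed with the topology $\tau_m$ generated by the seminorms $q_{m,g}$, $g\in\mathcal S_\omega(\mathbb R^N)$. Then for every integer $m\ge 1$: 1. The inclusion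 $\bigcup_{n\ge1}\mathcal O^m_{n,\omega}(\mathbb R^N)\hookrightarrow(\mathcal O^m_{s_\omega}(\mathbb R^N),\tau_m)$ is well defined and continuous. 2. $\bigcup_{n\ge1}\mathcal O^m_{n,\omega}(\mathbb R^N)=\mathcal O^m_{s_\omega}(\mathbb R^N)$ as vector spaces, and $\bigcup_{n\ge1}\mathcal O^m_{n,\omega}(\mathbb R^N)$ and $(\mathcal O^m_{s_\omega}(\mathbb R^N),\tau_m)$ have the same bounded sets. 3. $(\mathcal O^m_{s_\omega}(\mathbb R^N),\tau_m)$ is a Hausdorff locally convex space and, if $\varphi^*_\omega$ is real-valued on $[0,\infty)$ (equivalently, $\log t=o(\omega(t))$ as $t\to\infty$), it is complete. -/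

import Mathlib

open scoped ENNReal

namespace UltraMult

/-- Non-quasianalytic weight functions `ω : [0, ∞) → [0, ∞)`. Only the values of `ω` on `[0, ∞)`
matter. -/
structure IsNonquasianalyticWeight (ω : ℝ → ℝ) : Prop where
  nonneg : ∀ t, 0 ≤ t → 0 ≤ ω t
  continuousOn : ContinuousOn ω (Set.Ici 0)
  monotoneOn : MonotoneOn ω (Set.Ici 0)
  alpha : ∃ K : ℝ, 1 ≤ K ∧ ∀ t, 0 ≤ t → ω (2 * t) ≤ K * (1 + ω t)
  beta : MeasureTheory.IntegrableOn (fun t : ℝ => ω t / (1 + t ^ 2)) (Set.Ioi 1)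
  gamma : ∃ a b : ℝ, 0 < b ∧ ∀ t, 0 ≤ t → a + b * Real.log (1 + t) ≤ ω t
  delta : ConvexOn ℝ Set.univ (fun t : ℝ => ω (Real.exp t))

/-- The Young conjugate `φ*(s) = sup_{t ≥ 0} (s t - φ(t))` of `φ(t) = ω(exp t)`. It is kept
extended-valued, so that the supremum is the true one even when it is infinite. -/
noncomputable def youngConj (ω : ℝ → ℝ) (s : ℝ) : EReal :=
  ⨆ t : {t : ℝ // 0 ≤ t}, ((s * (t : ℝ) - ω (Real.exp t) : ℝ) : EReal)

/-- The factor `exp (-m φ*(k / m))`, with the convention `exp (-∞) = 0`. -/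
noncomputable def youngWeight (ω : ℝ → ℝ) (m k : ℕ) : ℝ≥0∞ :=
  EReal.exp (-(((m : ℝ) : EReal) * youngConj ω ((k : ℝ) / (m : ℝ))))

/-- Euclidean space `ℝ^N`. -/
abbrev Rn (N : ℕ) : Type := EuclideanSpace ℝ (Fin N)

/-- `f` is a complex-valued function of class `C^∞` on `ℝ^N`. -/
abbrev IsSmooth {N : ℕ} (f : Rn N → ℂ) : Prop := ContDiff ℝ ((⊤ : ℕ∞) : WithTop ℕ∞) f

/-- The partial derivative `∂f/∂x_i`. -/
noncomputable def pderiv {N : ℕ} (i : Fin N) (f : Rn N → ℂ) : Rn N → ℂ :=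
  fun x => lineDeriv ℝ f x (EuclideanSpace.single i 1)

/-- `∂^α f = ∂_0^{α_0} ∂_1^{α_1} ⋯ ∂_{N-1}^{α_{N-1}} f`. -/
noncomputable def mderiv {N : ℕ} (α : Fin N → ℕ) (f : Rn N → ℂ) : Rn N → ℂ :=
  (List.finRange N).foldr (fun i h => (pderiv i)^[α i] h) f

/-- The length `|α|` of a multi-index. -/
def len {N : ℕ} (α : Fin N → ℕ) : ℕ := ∑ i, α i

/-- The Fourier transform `f^(ξ) = ∫ f(x) exp(-i x·ξ) dx`. -/
noncomputable def fourierT {N : ℕ} (f : Rn N → ℂ) : Rn N → ℂ :=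
  fun ξ => ∫ x, f x * Complex.exp (-(Complex.I * ((inner ℝ x ξ : ℝ) : ℂ)))

/-- The set `S_ω(ℝ^N)` of `ω`-ultradifferentiable rapidly decreasing functions of Beurling
type. -/
def Sw (N : ℕ) (ω : ℝ → ℝ) : Set (Rn N → ℂ) :=
  {f | MeasureTheory.Integrable f ∧ IsSmooth f ∧ IsSmooth (fourierT f) ∧
    ∀ (l : ℝ) (α : Fin N → ℕ), 0 < l →
      (∃ C : ℝ, ∀ x, Real.exp (l * ω ‖x‖) * ‖mderiv α f x‖ ≤ C) ∧
      (∃ C : ℝ, ∀ ξ, Real.exp (l * ω ‖ξ‖) * ‖mderiv α (fourierT f) ξ‖ ≤ C)}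

/-- The weighted supremum `sup_α sup_x |∂^α f(x)| w(α, x)` in `[0, ∞]`. -/
noncomputable def wsup {N : ℕ} (w : (Fin N → ℕ) → Rn N → ℝ≥0∞) (f : Rn N → ℂ) : ℝ≥0∞ :=
  ⨆ (α : Fin N → ℕ) (x : Rn N), ‖mderiv α f x‖ₑ * w α x

/-- `r_{m,n}(f) = sup_α sup_x |∂^α f(x)| exp(-n ω(x) - m φ*(|α|/m))`. -/
noncomputable def r {N : ℕ} (ω : ℝ → ℝ) (m n : ℕ) : (Rn N → ℂ) → ℝ≥0∞ :=
  wsup fun α x => ENNReal.ofReal (Real.exp (-((n : ℝ) * ω ‖x‖))) * youngWeight ω m (len α)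

/-- `q_{m,g}(f) = sup_α sup_x |g(x)| |∂^α f(x)| exp(-m φ*(|α|/m))`. -/
noncomputable def q {N : ℕ} (ω : ℝ → ℝ) (m : ℕ) (g : Rn N → ℂ) : (Rn N → ℂ) → ℝ≥0∞ :=
  wsup fun α x => ‖g x‖ₑ * youngWeight ω m (len α)

section Helpers

variable {N : ℕ}

theorem contDiff_pderiv (i : Fin N) {f : Rn N → ℂ} (hf : IsSmooth f) :
    IsSmooth (pderiv i f) := by
  have h : pderiv i f = fun x => fderiv ℝ f x (EuclideanSpace.single i 1) := by
    funext x
    exact ((hf.differentiable (by simp)) x).lineDeriv_eq_fderiv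
  rw [h]
  exact (hf.fderiv_right (m := ((⊤ : ℕ∞) : WithTop ℕ∞)) (by simp)).clm_apply contDiff_const

theorem pderiv_add (i : Fin N) {f g : Rn N → ℂ} (hf : IsSmooth f) (hg : IsSmooth g) :
    pderiv i (f + g) = pderiv i f + pderiv i g := by
  funext x
  have h1 := (hf.differentiable (by simp)) x
  have h2 := (hg.differentiable (by simp)) x
  simp only [pderiv, Pi.add_apply]
  rw [(h1.add h2).lineDeriv_eq_fderiv, h1.lineDeriv_eq_fderiv, h2.lineDeriv_eq_fderiv,
    fderiv_add h1 h2]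
  rfl

theorem pderiv_smul (i : Fin N) (c : ℂ) {f : Rn N → ℂ} (hf : IsSmooth f) :
    pderiv i (c • f) = c • pderiv i f := by
  funext x
  have h1 := (hf.differentiable (by simp)) x
  simp only [pderiv, Pi.smul_apply]
  rw [(h1.const_smul c).lineDeriv_eq_fderiv, h1.lineDeriv_eq_fderiv, fderiv_const_smul h1]
  rfl

theorem contDiff_pderiv_iterate (i : Fin N) (k : ℕ) {f : Rn N → ℂ} (hf : IsSmooth f) :
    IsSmooth ((pderiv i)^[k] f) := by
  induction k with
  | zero => exact hf
  | succ k ih => rw [Function.iterate_succ_apply']; exact contDiff_pderiv i ih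

theorem pderiv_iterate_add (i : Fin N) (k : ℕ) {f g : Rn N → ℂ} (hf : IsSmooth f)
    (hg : IsSmooth g) :
    (pderiv i)^[k] (f + g) = (pderiv i)^[k] f + (pderiv i)^[k] g := by
  induction k with
  | zero => rfl
  | succ k ih =>
    simp only [Function.iterate_succ_apply']
    rw [ih, pderiv_add i (contDiff_pderiv_iterate i k hf) (contDiff_pderiv_iterate i k hg)]

theorem pderiv_iterate_smul (i : Fin N) (k : ℕ) (c : ℂ) {f : Rn N → ℂ} (hf : IsSmooth f) :
    (pderiv i)^[k] (c • f) = c • (pderiv i)^[k] f := by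
  induction k with
  | zero => rfl
  | succ k ih =>
    simp only [Function.iterate_succ_apply']
    rw [ih, pderiv_smul i c (contDiff_pderiv_iterate i k hf)]

theorem contDiff_mderiv (α : Fin N → ℕ) {f : Rn N → ℂ} (hf : IsSmooth f) :
    IsSmooth (mderiv α f) := by
  unfold mderiv
  induction List.finRange N with
  | nil => exact hf
  | cons i l ih => exact contDiff_pderiv_iterate i _ ih

theorem mderiv_add (α : Fin N → ℕ) {f g : Rn N → ℂ} (hf : IsSmooth f)
    (hg : IsSmooth g) : mderiv α (f + g) = mderiv α f + mderiv α g := by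
  have key : ∀ l : List (Fin N), ∀ h : Rn N → ℂ, IsSmooth h →
      IsSmooth (l.foldr (fun i h => (pderiv i)^[α i] h) h) := by
    intro l h hh
    induction l with
    | nil => exact hh
    | cons i l ih => exact contDiff_pderiv_iterate i _ ih
  unfold mderiv
  induction List.finRange N with
  | nil => rfl
  | cons i l ih =>
    simp only [List.foldr_cons]
    rw [ih, pderiv_iterate_add i _ (key l f hf) (key l g hg)]

theorem mderiv_smul (α : Fin N → ℕ) (c : ℂ) {f : Rn N → ℂ} (hf : IsSmooth f) :
    mderiv α (c • f) = c • mderiv α f := by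
  have key : ∀ l : List (Fin N), ∀ h : Rn N → ℂ, IsSmooth h →
      IsSmooth (l.foldr (fun i h => (pderiv i)^[α i] h) h) := by
    intro l h hh
    induction l with
    | nil => exact hh
    | cons i l ih => exact contDiff_pderiv_iterate i _ ih
  unfold mderiv
  induction List.finRange N with
  | nil => rfl
  | cons i l ih =>
    simp only [List.foldr_cons]
    rw [ih, pderiv_iterate_smul i _ c (key l f hf)]

theorem wsup_smul (w : (Fin N → ℕ) → Rn N → ℝ≥0∞) (c : ℂ) {f : Rn N → ℂ}
    (hf : IsSmooth f) : wsup w (c • f) = ‖c‖ₑ * wsup w f := by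
  simp only [wsup, ENNReal.mul_iSup]
  refine iSup_congr fun α => iSup_congr fun x => ?_
  rw [mderiv_smul α c hf, Pi.smul_apply, enorm_smul, mul_assoc]

theorem wsup_zero (w : (Fin N → ℕ) → Rn N → ℝ≥0∞) : wsup w (0 : Rn N → ℂ) = 0 := by
  have h := wsup_smul w 0 (f := (0 : Rn N → ℂ)) contDiff_const
  simpa using h

theorem wsup_add_le (w : (Fin N → ℕ) → Rn N → ℝ≥0∞) {f g : Rn N → ℂ}
    (hf : IsSmooth f) (hg : IsSmooth g) : wsup w (f + g) ≤ wsup w f + wsup w g := by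
  refine iSup_le fun α => iSup_le fun x => ?_
  rw [mderiv_add α hf hg, Pi.add_apply]
  calc ‖mderiv α f x + mderiv α g x‖ₑ * w α x
      ≤ (‖mderiv α f x‖ₑ + ‖mderiv α g x‖ₑ) * w α x := by gcongr; exact enorm_add_le _ _
    _ = ‖mderiv α f x‖ₑ * w α x + ‖mderiv α g x‖ₑ * w α x := add_mul _ _ _
    _ ≤ wsup w f + wsup w g := by
      gcongr
      · exact le_iSup₂ (f := fun α x => ‖mderiv α f x‖ₑ * w α x) α x
      · exact le_iSup₂ (f := fun α x => ‖mderiv α g x‖ₑ * w α x) α x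

theorem r_antitone {ω : ℝ → ℝ} (m : ℕ) {n n' : ℕ} (h : n ≤ n') (hω : ∀ t, 0 ≤ t → 0 ≤ ω t)
    (f : Rn N → ℂ) : r ω m n' f ≤ r ω m n f := by
  refine iSup₂_mono fun α x => ?_
  have h0 := hω _ (norm_nonneg x)
  have h1 : (n : ℝ) ≤ (n' : ℝ) := by exact_mod_cast h
  dsimp only
  gcongr

/-- A weighted supremum as a seminorm on a space of smooth functions on which it is finite. -/
noncomputable def wseminorm (V : Submodule ℂ (Rn N → ℂ)) (w : (Fin N → ℕ) → Rn N → ℝ≥0∞)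
    (hV : ∀ f ∈ V, IsSmooth f ∧ wsup w f < ⊤) : Seminorm ℂ V :=
  Seminorm.of (fun f => (wsup w (f : Rn N → ℂ)).toReal)
    (fun f g => by
      rw [← ENNReal.toReal_add (hV f f.2).2.ne (hV g g.2).2.ne]
      exact ENNReal.toReal_mono (ENNReal.add_ne_top.2 ⟨(hV f f.2).2.ne, (hV g g.2).2.ne⟩)
        (wsup_add_le w (hV f f.2).1 (hV g g.2).1))
    (fun c f => by
      rw [Submodule.coe_smul, wsup_smul w c (hV f f.2).1, ENNReal.toReal_mul, toReal_enorm])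

end Helpers

/-! ### The steps `O^m_{n,ω}` and their union -/

/-- `O^m_{n,ω}(ℝ^N)`: the smooth `f` with `r_{m,n}(f) < ∞`. -/
noncomputable def stepSubmodule (N : ℕ) (ω : ℝ → ℝ) (m n : ℕ) : Submodule ℂ (Rn N → ℂ) where
  carrier := {f | IsSmooth f ∧ r ω m n f < ⊤}
  zero_mem' := ⟨contDiff_const, by rw [r, wsup_zero]; exact ENNReal.zero_lt_top⟩
  add_mem' := fun hf hg => ⟨hf.1.add hg.1,
    (wsup_add_le _ hf.1 hg.1).trans_lt (ENNReal.add_lt_top.2 ⟨hf.2, hg.2⟩)⟩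
  smul_mem' := fun c f hf => ⟨contDiff_const.smul hf.1, by
    rw [r, wsup_smul _ c hf.1]; exact ENNReal.mul_lt_top enorm_lt_top hf.2⟩

theorem stepSubmodule_mono {N : ℕ} {ω : ℝ → ℝ} (m : ℕ) {n n' : ℕ} (h : n ≤ n')
    (hω : ∀ t, 0 ≤ t → 0 ≤ ω t) : stepSubmodule N ω m n ≤ stepSubmodule N ω m n' :=
  fun f hf => ⟨hf.1, (r_antitone m h hω f).trans_lt hf.2⟩

/-- The topology of `O^m_{n,ω}(ℝ^N)` given by the norm `r_{m,n}`. -/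
@[reducible]
noncomputable def stepTopology (N : ℕ) (ω : ℝ → ℝ) (m n : ℕ) :
    TopologicalSpace (stepSubmodule N ω m n) :=
  (wseminorm (stepSubmodule N ω m n) _
    (fun _ hf => hf)).toSeminormedAddCommGroup.toUniformSpace.toTopologicalSpace


/-- `⋃_{n ≥ 1} O^m_{n,ω}(ℝ^N)`, as a space of functions. -/
noncomputable def unionSubmodule (N : ℕ) (ω : ℝ → ℝ) (hω : IsNonquasianalyticWeight ω) (m : ℕ) :
    Submodule ℂ (Rn N → ℂ) where
  carrier := ⋃ n : ℕ+, (stepSubmodule N ω m n : Set (Rn N → ℂ))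
  zero_mem' := Set.mem_iUnion.2 ⟨1, (stepSubmodule N ω m _).zero_mem⟩
  add_mem' := fun {f g} hf hg => by
    obtain ⟨n, hn⟩ := Set.mem_iUnion.1 hf
    obtain ⟨k, hk⟩ := Set.mem_iUnion.1 hg
    exact Set.mem_iUnion.2 ⟨n + k, (stepSubmodule N ω m _).add_mem
      (stepSubmodule_mono m (by simp) hω.nonneg hn) (stepSubmodule_mono m (by simp) hω.nonneg hk)⟩
  smul_mem' := fun c f hf => by
    obtain ⟨n, hn⟩ := Set.mem_iUnion.1 hf
    exact Set.mem_iUnion.2 ⟨n, (stepSubmodule N ω m _).smul_mem c hn⟩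

theorem stepSubmodule_le_union {N : ℕ} {ω : ℝ → ℝ} (hω : IsNonquasianalyticWeight ω) (m : ℕ)
    (n : ℕ+) : stepSubmodule N ω m n ≤ unionSubmodule N ω hω m :=
  fun _ hf => Set.mem_iUnion.2 ⟨n, hf⟩

/-- The space `⋃_{n ≥ 1} O^m_{n,ω}(ℝ^N)`, to be endowed with its inductive limit topology. -/
def UnionO (N : ℕ) (ω : ℝ → ℝ) (hω : IsNonquasianalyticWeight ω) (m : ℕ) : Type :=
  ↥(unionSubmodule N ω hω m)

noncomputable instance (N : ℕ) (ω : ℝ → ℝ) (hω : IsNonquasianalyticWeight ω) (m : ℕ) :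
    AddCommGroup (UnionO N ω hω m) :=
  inferInstanceAs (AddCommGroup ↥(unionSubmodule N ω hω m))

noncomputable instance (N : ℕ) (ω : ℝ → ℝ) (hω : IsNonquasianalyticWeight ω) (m : ℕ) :
    Module ℂ (UnionO N ω hω m) :=
  inferInstanceAs (Module ℂ ↥(unionSubmodule N ω hω m))

/-- The function underlying an element of `⋃_{n ≥ 1} O^m_{n,ω}(ℝ^N)`. -/
def UnionO.toFun {N : ℕ} {ω : ℝ → ℝ} {hω : IsNonquasianalyticWeight ω} {m : ℕ}
    (f : UnionO N ω hω m) : Rn N → ℂ := Subtype.val f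

/-- The inclusion `O^m_{n,ω} → ⋃_{n ≥ 1} O^m_{n,ω}`. -/
noncomputable def stepInclusion (N : ℕ) (ω : ℝ → ℝ) (hω : IsNonquasianalyticWeight ω) (m : ℕ) (n : ℕ+) :
    ↥(stepSubmodule N ω m n) → UnionO N ω hω m :=
  Submodule.inclusion (stepSubmodule_le_union hω m n)

/-- The (LB)-topology, i.e. the locally convex inductive limit topology: the finest locally convex
vector space topology making all inclusions of the steps continuous. (For topologies on a type,
`t₁ ≤ t₂` means that `t₁` is finer than `t₂`.) -/
noncomputable instance (N : ℕ) (ω : ℝ → ℝ) (hω : IsNonquasianalyticWeight ω) (m : ℕ) :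
    TopologicalSpace (UnionO N ω hω m) :=
  sInf {t | (∀ n : ℕ+, @Continuous _ _ (stepTopology N ω m n) t (stepInclusion N ω hω m n)) ∧
    @IsTopologicalAddGroup _ t _ ∧ @ContinuousSMul ℂ _ _ _ t ∧
    @LocallyConvexSpace ℝ _ _ _ _ _ t}

/-! ### The space `O^m_{s_ω}` with the topology `τ_m` -/

/-- `O^m_{s_ω}(ℝ^N)`, as a space of functions: the smooth `f` with `q_{m,g}(f) < ∞` for all
`g ∈ S_ω(ℝ^N)`. -/
noncomputable def sSubmodule (N : ℕ) (ω : ℝ → ℝ) (m : ℕ) : Submodule ℂ (Rn N → ℂ) where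
  carrier := {f | IsSmooth f ∧ ∀ g ∈ Sw N ω, q ω m g f < ⊤}
  zero_mem' := ⟨contDiff_const, fun g _ => by rw [q, wsup_zero]; exact ENNReal.zero_lt_top⟩
  add_mem' := fun hf hg => ⟨hf.1.add hg.1, fun u hu =>
    (wsup_add_le _ hf.1 hg.1).trans_lt (ENNReal.add_lt_top.2 ⟨hf.2 u hu, hg.2 u hu⟩)⟩
  smul_mem' := fun c f hf => ⟨contDiff_const.smul hf.1, fun u hu => by
    rw [q, wsup_smul _ c hf.1]; exact ENNReal.mul_lt_top enorm_lt_top (hf.2 u hu)⟩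

/-- The space `O^m_{s_ω}(ℝ^N)`, to be endowed with the topology `τ_m`. -/
def SpaceO (N : ℕ) (ω : ℝ → ℝ) (m : ℕ) : Type := ↥(sSubmodule N ω m)

noncomputable instance (N : ℕ) (ω : ℝ → ℝ) (m : ℕ) : AddCommGroup (SpaceO N ω m) :=
  inferInstanceAs (AddCommGroup ↥(sSubmodule N ω m))

noncomputable instance (N : ℕ) (ω : ℝ → ℝ) (m : ℕ) : Module ℂ (SpaceO N ω m) :=
  inferInstanceAs (Module ℂ ↥(sSubmodule N ω m))

/-- The function underlying an element of `O^m_{s_ω}(ℝ^N)`. -/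
def SpaceO.toFun {N : ℕ} {ω : ℝ → ℝ} {m : ℕ} (f : SpaceO N ω m) : Rn N → ℂ := Subtype.val f

/-- The seminorms `q_{m,g}`, `g ∈ S_ω(ℝ^N)`, on `O^m_{s_ω}(ℝ^N)`. -/
noncomputable def qFamily (N : ℕ) (ω : ℝ → ℝ) (m : ℕ) :
    SeminormFamily ℂ (SpaceO N ω m) (Sw N ω) :=
  fun g => wseminorm (sSubmodule N ω m) _ (fun _ hf => ⟨hf.1, hf.2 g g.2⟩)

/-- The topology `τ_m`, generated by the seminorms `q_{m,g}`, `g ∈ S_ω(ℝ^N)`. -/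
noncomputable instance (N : ℕ) (ω : ℝ → ℝ) (m : ℕ) : TopologicalSpace (SpaceO N ω m) :=
  (qFamily N ω m).moduleFilterBasis.topology

theorem withSeminorms_qFamily (N : ℕ) (ω : ℝ → ℝ) (m : ℕ) : WithSeminorms (qFamily N ω m) :=
  ⟨rfl⟩

instance (N : ℕ) (ω : ℝ → ℝ) (m : ℕ) : IsTopologicalAddGroup (SpaceO N ω m) :=
  (withSeminorms_qFamily N ω m).topologicalAddGroup

theorem qFamily_apply {N : ℕ} {ω : ℝ → ℝ} {m : ℕ} (g : Sw N ω) (f : SpaceO N ω m) :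
    qFamily N ω m g f = (q ω m (g : Rn N → ℂ) f.toFun).toReal := rfl

end UltraMult

open UltraMult

namespace UltraMult

variable {N : ℕ}

theorem IsSmooth.differentiableAt {f : Rn N → ℂ} (hf : IsSmooth f) (x : Rn N) :
    DifferentiableAt ℝ f x :=
  (hf.differentiable (by simp)) x

theorem pderiv_eq_fderiv (i : Fin N) {f : Rn N → ℂ} (hf : IsSmooth f) :
    pderiv i f = fun x => fderiv ℝ f x (EuclideanSpace.single i 1) :=
  funext fun x => (IsSmooth.differentiableAt hf x).lineDeriv_eq_fderiv

theorem pderiv_comm (i j : Fin N) {f : Rn N → ℂ} (hf : IsSmooth f) :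
    pderiv i (pderiv j f) = pderiv j (pderiv i f) := by
  have h2 : ∀ k l : Fin N, ∀ x, pderiv k (pderiv l f) x =
      fderiv ℝ (fderiv ℝ f) x (EuclideanSpace.single k 1) (EuclideanSpace.single l 1) := by
    intro k l x
    rw [pderiv_eq_fderiv k (contDiff_pderiv l hf), pderiv_eq_fderiv l hf]
    have hd : DifferentiableAt ℝ (fderiv ℝ f) x :=
      ((hf.fderiv_right (m := ((⊤ : ℕ∞) : WithTop ℕ∞)) (by simp)).differentiable (by simp)) x
    dsimp only
    rw [fderiv_clm_apply hd (differentiableAt_const _)]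
    simp
  funext x
  rw [h2, h2]
  have hs : IsSymmSndFDerivAt ℝ f x := hf.contDiffAt.isSymmSndFDerivAt (by
    simp only [minSmoothness_of_isRCLikeNormedField]
    exact WithTop.coe_le_coe.2 le_top)
  exact hs _ _

theorem pderiv_iterate_comm (i j : Fin N) (k : ℕ) {f : Rn N → ℂ} (hf : IsSmooth f) :
    pderiv i ((pderiv j)^[k] f) = (pderiv j)^[k] (pderiv i f) := by
  induction k with
  | zero => rfl
  | succ k ih =>
    rw [Function.iterate_succ_apply', Function.iterate_succ_apply',
      pderiv_comm i j (contDiff_pderiv_iterate j k hf), ih]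

theorem mderiv_zero (f : Rn N → ℂ) : mderiv 0 f = f := by
  unfold mderiv
  induction List.finRange N with
  | nil => rfl
  | cons i l ih => simp

theorem pderiv_mderiv (i : Fin N) (α : Fin N → ℕ) {f : Rn N → ℂ} (hf : IsSmooth f) :
    pderiv i (mderiv α f) = mderiv (α + Pi.single i 1) f := by
  have hs : ∀ l : List (Fin N), IsSmooth (l.foldr (fun i h => (pderiv i)^[α i] h) f) := by
    intro l
    induction l with
    | nil => exact hf
    | cons i l ih => exact contDiff_pderiv_iterate i _ ih
  have key : ∀ l : List (Fin N), l.Nodup →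
      l.foldr (fun j h => (pderiv j)^[(α + Pi.single i 1 : Fin N → ℕ) j] h) f =
        if i ∈ l then pderiv i (l.foldr (fun j h => (pderiv j)^[α j] h) f)
        else l.foldr (fun j h => (pderiv j)^[α j] h) f := by
    intro l hl
    induction l with
    | nil => rfl
    | cons j l ih =>
      obtain ⟨hj, hl⟩ := List.nodup_cons.1 hl
      simp only [List.foldr_cons]
      rw [ih hl]
      by_cases hij : i = j
      · subst hij
        simp [hj, Function.iterate_succ_apply']
      · by_cases hil : i ∈ l
        · simp [hij, hil, Ne.symm hij, pderiv_iterate_comm i j _ (hs l)]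
        · simp [hij, hil, Ne.symm hij]
  have := key (List.finRange N) (List.nodup_finRange N)
  simp only [List.mem_finRange, if_true] at this
  exact this.symm

theorem len_add_single (α : Fin N → ℕ) (i : Fin N) :
    len (α + Pi.single i 1) = len α + 1 := by
  simp [len, Finset.sum_add_distrib]

theorem multiIndex_induction {p : (Fin N → ℕ) → Prop} (zero : p 0)
    (add_single : ∀ α i, p α → p (α + Pi.single i 1)) (α : Fin N → ℕ) : p α := by
  induction hk : len α generalizing α with
  | zero =>
    have : α = 0 := by
      funext i
      simpa using (Finset.sum_eq_zero_iff.1 hk) i (Finset.mem_univ i)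
    rwa [this]
  | succ k ih =>
    obtain ⟨i, hi⟩ : ∃ i, α i ≠ 0 := by
      by_contra! h
      simp [len, h] at hk
    have hα : α = (α - Pi.single i 1) + Pi.single i 1 := by
      funext j
      by_cases hj : j = i
      · subst hj; simp; omega
      · simp [hj]
    rw [hα]
    refine add_single _ _ (ih _ ?_)
    rw [hα, len_add_single] at hk
    omega

theorem norm_iteratedFDeriv_pderiv_le (i : Fin N) (k : ℕ) {f : Rn N → ℂ} (hf : IsSmooth f)
    (x : Rn N) : ‖iteratedFDeriv ℝ k (pderiv i f) x‖ ≤ ‖iteratedFDeriv ℝ (k + 1) f x‖ := by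
  rw [pderiv_eq_fderiv i hf, ← norm_iteratedFDeriv_fderiv]
  have hd : ContDiff ℝ ((⊤ : ℕ∞) : WithTop ℕ∞) (fderiv ℝ f) := hf.fderiv_right (by simp)
  refine (norm_iteratedFDeriv_clm_apply_const (n := k) (hd.contDiffAt (x := x)) (by
    exact_mod_cast le_top)).trans ?_
  simp

theorem norm_mderiv_le (α : Fin N → ℕ) {f : Rn N → ℂ} (hf : IsSmooth f) (x : Rn N) :
    ‖mderiv α f x‖ ≤ ‖iteratedFDeriv ℝ (len α) f x‖ := by
  have key : ∀ k n, n = k + len α →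
      ‖iteratedFDeriv ℝ k (mderiv α f) x‖ ≤ ‖iteratedFDeriv ℝ n f x‖ := by
    induction α using multiIndex_induction with
    | zero =>
      intro k n hn
      obtain rfl : n = k := by simpa [len] using hn
      rw [mderiv_zero]
    | add_single α i ih =>
      intro k n hn
      rw [← pderiv_mderiv i α hf]
      refine (norm_iteratedFDeriv_pderiv_le i k (contDiff_mderiv α hf) x).trans (ih _ _ ?_)
      rw [hn, len_add_single]
      omega
  simpa only [norm_iteratedFDeriv_zero] using key 0 (len α) (zero_add _).symm

/-- The derivative of `∂^α f` in terms of its partial derivatives. -/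
theorem fderiv_mderiv (α : Fin N → ℕ) {f : Rn N → ℂ} (hf : IsSmooth f) (x : Rn N) :
    fderiv ℝ (mderiv α f) x = ∑ i, (EuclideanSpace.proj i : Rn N →L[ℝ] ℝ).smulRight
      (mderiv (α + Pi.single i 1) f x) := by
  refine ContinuousLinearMap.coe_injective
    ((EuclideanSpace.basisFun (Fin N) ℝ).toBasis.ext fun j => ?_)
  have h : fderiv ℝ (mderiv α f) x (EuclideanSpace.single j 1) =
      mderiv (α + Pi.single j 1) f x := by
    rw [← pderiv_mderiv j α hf, pderiv_eq_fderiv j (contDiff_mderiv α hf)]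
  simp [h]
  rw [Finset.sum_eq_single_of_mem j (Finset.mem_univ j) (fun k _ hk => by simp [hk])]
  simp

variable {ω : ℝ → ℝ}

open MeasureTheory in
theorem IsNonquasianalyticWeight.exists_le_linear (hω : IsNonquasianalyticWeight ω) :
    ∃ A : ℝ, 0 ≤ A ∧ ∀ t, 0 ≤ t → ω t ≤ A * (1 + t) := by
  set I := ∫ t in Set.Ioi (1 : ℝ), ω t / (1 + t ^ 2)
  have hnn : ∀ t ∈ Set.Ioi (1 : ℝ), 0 ≤ ω t / (1 + t ^ 2) := fun t ht =>
    div_nonneg (hω.nonneg t (zero_le_one.trans (le_of_lt ht))) (by positivity)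
  have hI : 0 ≤ I := setIntegral_nonneg measurableSet_Ioi hnn
  have h1 : ∀ T : ℝ, 1 ≤ T → ω T / (2 * T) ≤ I := by
    intro T hT
    have hT0 : 0 < T := by linarith
    have hint : IntegrableOn (fun t : ℝ => ω T / 2 * t ^ (-2 : ℝ)) (Set.Ioi T) :=
      (integrableOn_Ioi_rpow_of_lt (by norm_num) hT0).const_mul _
    have hval : ∫ t in Set.Ioi T, ω T / 2 * t ^ (-2 : ℝ) = ω T / (2 * T) := by
      rw [integral_const_mul, integral_Ioi_rpow_of_lt (by norm_num) hT0]
      norm_num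
      rw [Real.rpow_neg_one]
      field_simp
    have hsub : Set.Ioi T ⊆ Set.Ioi (1 : ℝ) := Set.Ioi_subset_Ioi hT
    rw [← hval]
    calc ∫ t in Set.Ioi T, ω T / 2 * t ^ (-2 : ℝ)
        ≤ ∫ t in Set.Ioi T, ω t / (1 + t ^ 2) := by
          refine setIntegral_mono_on hint (hω.beta.mono_set hsub) measurableSet_Ioi ?_
          intro t ht
          have ht' : T < t := ht
          have ht0 : 0 < t := by linarith
          have hm : ω T ≤ ω t := hω.monotoneOn hT0.le ht0.le ht'.le
          rw [Real.rpow_neg ht0.le, div_mul_eq_mul_div, Real.rpow_two, ← div_eq_mul_inv, div_div]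
          have := hω.nonneg T hT0.le
          exact div_le_div₀ (this.trans hm) hm (by positivity) (by nlinarith)
      _ ≤ I := setIntegral_mono_set hω.beta
          ((ae_restrict_mem measurableSet_Ioi).mono hnn) (Filter.Eventually.of_forall hsub)
  refine ⟨2 * I, by positivity, fun t ht => ?_⟩
  have h2 := h1 (1 + t) (by linarith)
  rw [div_le_iff₀ (by positivity)] at h2
  have := hω.monotoneOn ht (by simp; linarith : (1 + t) ∈ Set.Ici (0 : ℝ)) (by linarith)
  linarith

theorem IsNonquasianalyticWeight.exists_le_add (hω : IsNonquasianalyticWeight ω) (N : ℕ) :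
    ∃ K : ℝ, 0 ≤ K ∧ ∀ x a : Rn N, ω ‖x‖ ≤ K * (2 + ω ‖x - a‖ + ω ‖a‖) := by
  obtain ⟨K, hK, h⟩ := hω.alpha
  refine ⟨K, by linarith, fun x a => ?_⟩
  have h1 : ∀ s t : ℝ, 0 ≤ s → s ≤ t → ω (s + t) ≤ K * (1 + ω t) := fun s t hs hst =>
    (hω.monotoneOn (Set.mem_Ici.2 (by linarith)) (Set.mem_Ici.2 (by linarith))
      (by linarith)).trans (h t (hs.trans hst))
  have h2 : ω ‖x‖ ≤ ω (‖x - a‖ + ‖a‖) :=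
    hω.monotoneOn (norm_nonneg _) (add_nonneg (norm_nonneg (x - a)) (norm_nonneg a))
      (by simpa using norm_add_le (x - a) a)
  have h3 := hω.nonneg _ (norm_nonneg (x - a))
  have h4 := hω.nonneg _ (norm_nonneg a)
  rcases le_total ‖x - a‖ ‖a‖ with h5 | h5
  · have := h1 _ _ (norm_nonneg _) h5
    nlinarith
  · have := h1 _ _ (norm_nonneg _) h5
    rw [add_comm] at this
    nlinarith

theorem IsNonquasianalyticWeight.exists_one_add_le_exp (hω : IsNonquasianalyticWeight ω) :
    ∃ B : ℝ, 0 < B ∧ ∀ t, 0 ≤ t → 1 + t ≤ Real.exp (B * (1 + ω t)) := by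
  obtain ⟨a, b, hb, h⟩ := hω.gamma
  refine ⟨(1 + |a|) / b, by positivity, fun t ht => ?_⟩
  rw [← Real.log_le_iff_le_exp (by linarith), div_mul_eq_mul_div, le_div_iff₀ hb]
  have h1 := h t ht
  have h2 := hω.nonneg t ht
  nlinarith [neg_abs_le a, abs_nonneg a, mul_nonneg (abs_nonneg a) h2]

/-- The standard Gaussian, as a complex-valued function. -/
noncomputable def gauss (x : Rn N) : ℂ := ((Real.exp (-(1 / 2) * ‖x‖ ^ 2) : ℝ) : ℂ)

theorem isSmooth_gauss : IsSmooth (gauss : Rn N → ℂ) :=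
  Complex.ofRealCLM.contDiff.comp (Real.contDiff_exp.comp (contDiff_const.mul (contDiff_norm_sq ℝ)))

theorem exists_exp_mul_norm_iteratedFDeriv_gauss_le (k : ℕ) (l : ℝ) :
    ∃ C : ℝ, ∀ x : Rn N, Real.exp (l * ‖x‖) * ‖iteratedFDeriv ℝ k gauss x‖ ≤ C := by
  have htemp : (fun x : Rn N => -(1 / 2 : ℝ) * ‖x‖ ^ 2).HasTemperateGrowth := by
    have := Function.hasTemperateGrowth_norm_sq (H := Rn N)
    fun_prop
  obtain ⟨p, D, hD, hbound⟩ := htemp.norm_iteratedFDeriv_le_uniform k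
  have h1 : ∀ x : Rn N, ‖iteratedFDeriv ℝ k gauss x‖ ≤
      k.factorial * Real.exp (-(1 / 2) * ‖x‖ ^ 2) * ((1 + D) * (1 + ‖x‖) ^ p) ^ k := by
    intro x
    have hcomp : (gauss : Rn N → ℂ) =
        Complex.ofRealLI ∘ (Real.exp ∘ fun x : Rn N => -(1 / 2 : ℝ) * ‖x‖ ^ 2) := rfl
    have hsm : ContDiff ℝ ((⊤ : ℕ∞) : WithTop ℕ∞) (Real.exp ∘ fun x : Rn N => -(1 / 2 : ℝ) * ‖x‖ ^ 2) :=
      Real.contDiff_exp.comp htemp.1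
    rw [hcomp, LinearIsometry.norm_iteratedFDeriv_comp_left _ (hsm.contDiffAt)
      (by exact_mod_cast le_top)]
    refine norm_iteratedFDeriv_comp_le Real.contDiff_exp htemp.1 (by exact_mod_cast le_top) x ?_ ?_
    · intro i _
      rw [norm_iteratedFDeriv_eq_norm_iteratedDeriv, iteratedDeriv_eq_iterate, Real.iter_deriv_exp]
      simp
    · intro i hi hik
      have hx : 1 ≤ (1 + ‖x‖) ^ p := one_le_pow₀ (by linarith [norm_nonneg x])
      have h1 : 1 ≤ (1 + D) * (1 + ‖x‖) ^ p := by nlinarith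
      calc ‖iteratedFDeriv ℝ i (fun x : Rn N => -(1 / 2 : ℝ) * ‖x‖ ^ 2) x‖
          ≤ D * (1 + ‖x‖) ^ p := hbound i hik x
        _ ≤ (1 + D) * (1 + ‖x‖) ^ p := by gcongr; linarith
        _ ≤ _ := le_self_pow₀ h1 (by omega)
  refine ⟨k.factorial * (1 + D) ^ k * Real.exp ((l + p * k) ^ 2 / 2), fun x => ?_⟩
  have h2 : (1 + ‖x‖) ^ (p * k) ≤ Real.exp (p * k * ‖x‖) := by
    calc (1 + ‖x‖) ^ (p * k) ≤ (Real.exp ‖x‖) ^ (p * k) := by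
          gcongr; linarith [Real.add_one_le_exp ‖x‖]
      _ = _ := by rw [← Real.exp_nat_mul]; push_cast; rfl
  calc Real.exp (l * ‖x‖) * ‖iteratedFDeriv ℝ k gauss x‖
      ≤ Real.exp (l * ‖x‖) *
        (k.factorial * Real.exp (-(1 / 2) * ‖x‖ ^ 2) * ((1 + D) * (1 + ‖x‖) ^ p) ^ k) := by
        gcongr; exact h1 x
    _ = k.factorial * (1 + D) ^ k *
        (Real.exp (l * ‖x‖) * Real.exp (-(1 / 2) * ‖x‖ ^ 2) * (1 + ‖x‖) ^ (p * k)) := by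
        rw [mul_pow, pow_mul]; ring
    _ ≤ k.factorial * (1 + D) ^ k *
        (Real.exp (l * ‖x‖) * Real.exp (-(1 / 2) * ‖x‖ ^ 2) * Real.exp (p * k * ‖x‖)) := by
        gcongr
    _ ≤ _ := by
        rw [← Real.exp_add, ← Real.exp_add]
        gcongr
        nlinarith [sq_nonneg (l + p * k - ‖x‖)]

/-- The character `ξ ↦ exp (-i a·ξ)`. -/
noncomputable def character (a ξ : Rn N) : ℂ :=
  Complex.exp (-(Complex.I * ((inner ℝ a ξ : ℝ) : ℂ)))

theorem isSmooth_character (a : Rn N) : IsSmooth (character a) := by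
  unfold character
  refine Complex.contDiff_exp.comp (contDiff_const.mul ?_).neg
  exact Complex.ofRealCLM.contDiff.comp (contDiff_const.inner ℝ contDiff_id)

theorem norm_iteratedFDeriv_character_le (a ξ : Rn N) (k : ℕ) :
    ‖iteratedFDeriv ℝ k (character a) ξ‖ ≤ ‖a‖ ^ k := by
  set h : ℝ → ℂ := fun t => Complex.exp (-(Complex.I * (t : ℂ)))
  have hs : ContDiff ℝ ((⊤ : ℕ∞) : WithTop ℕ∞) h :=
    Complex.contDiff_exp.comp (contDiff_const.mul Complex.ofRealCLM.contDiff).neg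
  have hd : ∀ n, iteratedDeriv n h = fun t => (-Complex.I) ^ n * h t := by
    intro n
    induction n with
    | zero => simp
    | succ n ih =>
      funext t
      rw [iteratedDeriv_succ, ih]
      have h1 : HasDerivAt h (h t * -(Complex.I * 1)) t :=
        (((hasDerivAt_id t).ofReal_comp.const_mul Complex.I).neg).cexp
      rw [(h1.const_mul _).deriv]
      ring
  have hcomp : character a = h ∘ (innerSL ℝ a : Rn N →L[ℝ] ℝ) := rfl
  rw [hcomp, ContinuousLinearMap.iteratedFDeriv_comp_right _ hs _ (by exact_mod_cast le_top)]
  refine (ContinuousMultilinearMap.norm_compContinuousLinearMap_le _ _).trans ?_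
  rw [norm_iteratedFDeriv_eq_norm_iteratedDeriv, hd]
  have : ‖h (innerSL ℝ a ξ)‖ = 1 := by
    simp only [h]
    rw [← mul_neg, mul_comm, ← Complex.ofReal_neg, Complex.norm_exp_ofReal_mul_I]
  rw [norm_mul, this]
  simp

theorem integrable_gauss : MeasureTheory.Integrable (gauss : Rn N → ℂ) := by
  have := GaussianFourier.integrable_cexp_neg_mul_sq_norm_add (V := Rn N) (b := 1 / 2)
    (by norm_num) 0 0
  refine this.congr (Filter.Eventually.of_forall fun x => ?_)
  simp [gauss]

/-- The factor relating the Gaussian to its Fourier transform. -/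
noncomputable def gaussFactor (N : ℕ) : ℂ := (Real.pi / (1 / 2 : ℂ)) ^ ((N : ℂ) / 2)

theorem fourierT_gauss_sub (a : Rn N) :
    fourierT (fun x => gauss (x - a)) = fun ξ => gaussFactor N * (character a ξ * gauss ξ) := by
  funext ξ
  unfold fourierT
  rw [← MeasureTheory.integral_add_right_eq_self _ a]
  have h := GaussianFourier.integral_cexp_neg_mul_sq_norm_add (V := Rn N) (b := 1 / 2)
    (by norm_num) (-Complex.I) ξ
  have h2 : ∀ v : Rn N, gauss (v + a - a) *
      Complex.exp (-(Complex.I * ((inner ℝ (v + a) ξ : ℝ) : ℂ))) =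
      character a ξ * Complex.exp (-(1 / 2) * (‖v‖ : ℂ) ^ 2 + -Complex.I * (inner ℝ ξ v : ℝ)) := by
    intro v
    rw [add_sub_cancel_right, gauss, character, Complex.ofReal_exp, ← Complex.exp_add,
      ← Complex.exp_add, inner_add_left, real_inner_comm ξ v]
    congr 1
    push_cast
    ring
  simp_rw [h2]
  rw [MeasureTheory.integral_const_mul, h, gaussFactor, gauss]
  simp only [finrank_euclideanSpace, Fintype.card_fin]
  have h3 : Complex.exp ((-Complex.I) ^ 2 * (‖ξ‖ : ℂ) ^ 2 / (4 * (1 / 2))) =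
      ((Real.exp (-(1 / 2) * ‖ξ‖ ^ 2) : ℝ) : ℂ) := by
    rw [Complex.ofReal_exp]
    congr 1
    push_cast
    rw [neg_sq, Complex.I_sq]
    ring
  rw [h3]
  ring

/-- All derivatives of the smooth function `f` decay faster than every `exp (-l ω)`. -/
def RapidDecay (ω : ℝ → ℝ) (f : Rn N → ℂ) : Prop :=
  IsSmooth f ∧ ∀ (k : ℕ) (l : ℝ), ∃ C : ℝ, ∀ x,
    Real.exp (l * ω ‖x‖) * ‖iteratedFDeriv ℝ k f x‖ ≤ C

theorem iteratedFDeriv_const_mul_of_isSmooth {f : Rn N → ℂ} (hf : IsSmooth f) (c : ℂ) (k : ℕ)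
    (x : Rn N) : iteratedFDeriv ℝ k (fun x => c * f x) x = c • iteratedFDeriv ℝ k f x := by
  change iteratedFDeriv ℝ k (c • f) x = _
  exact iteratedFDeriv_const_smul_apply (hf.contDiffAt.of_le (by exact_mod_cast le_top))

theorem RapidDecay.const_mul {f : Rn N → ℂ} (hf : RapidDecay ω f) (c : ℂ) :
    RapidDecay ω fun x => c * f x := by
  refine ⟨contDiff_const.mul hf.1, fun k l => ?_⟩
  obtain ⟨C, hC⟩ := hf.2 k l
  refine ⟨‖c‖ * C, fun x => ?_⟩
  rw [iteratedFDeriv_const_mul_of_isSmooth hf.1, norm_smul, mul_left_comm]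
  exact mul_le_mul_of_nonneg_left (hC x) (norm_nonneg c)

theorem RapidDecay.norm_mderiv_le {f : Rn N → ℂ} (hf : RapidDecay ω f) (l : ℝ)
    (α : Fin N → ℕ) : ∃ C : ℝ, ∀ x, Real.exp (l * ω ‖x‖) * ‖mderiv α f x‖ ≤ C := by
  obtain ⟨C, hC⟩ := hf.2 (len α) l
  refine ⟨C, fun x => le_trans ?_ (hC x)⟩
  gcongr
  exact UltraMult.norm_mderiv_le α hf.1 x

theorem RapidDecay.integrable (hω : IsNonquasianalyticWeight ω) {f : Rn N → ℂ}
    (hf : RapidDecay ω f) : MeasureTheory.Integrable f := by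
  obtain ⟨B, hB, h⟩ := hω.exists_one_add_le_exp
  obtain ⟨C, hC⟩ := hf.2 0 (B * (N + 1))
  have hi : MeasureTheory.Integrable
      (fun x : Rn N => (Real.exp (B * (N + 1)) * C) * (1 + ‖x‖) ^ (-((N : ℝ) + 1))) :=
    (integrable_one_add_norm (by simp)).const_mul _
  refine hi.mono' hf.1.continuous.aestronglyMeasurable (Filter.Eventually.of_forall fun x => ?_)
  have h1 : 0 < 1 + ‖x‖ := by positivity
  rw [Real.rpow_neg h1.le, ← div_eq_mul_inv, le_div_iff₀ (by positivity)]
  have h2 : (1 + ‖x‖) ^ ((N : ℝ) + 1) ≤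
      Real.exp (B * (N + 1)) * Real.exp (B * (N + 1) * ω ‖x‖) := by
    calc (1 + ‖x‖) ^ ((N : ℝ) + 1) ≤ (Real.exp (B * (1 + ω ‖x‖))) ^ ((N : ℝ) + 1) := by
          gcongr; exact h _ (norm_nonneg x)
      _ = _ := by rw [← Real.exp_mul, ← Real.exp_add]; congr 1; ring
  have h3 := hC x
  rw [norm_iteratedFDeriv_zero] at h3
  calc ‖f x‖ * (1 + ‖x‖) ^ ((N : ℝ) + 1)
      ≤ ‖f x‖ * (Real.exp (B * (N + 1)) * Real.exp (B * (N + 1) * ω ‖x‖)) := by gcongr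
    _ = Real.exp (B * (N + 1)) * (Real.exp (B * (N + 1) * ω ‖x‖) * ‖f x‖) := by ring
    _ ≤ _ := by gcongr

theorem mem_Sw_of_rapidDecay (hω : IsNonquasianalyticWeight ω) {f : Rn N → ℂ}
    (hf : RapidDecay ω f) (hf' : RapidDecay ω (fourierT f)) : f ∈ Sw N ω :=
  ⟨hf.integrable hω, hf.1, hf'.1, fun l α _ => ⟨hf.norm_mderiv_le l α, hf'.norm_mderiv_le l α⟩⟩

/-- A family of functions indexed by points of `ℝ^N` whose decay is controlled by a power of
`exp (ω a)`, `a` being the index. -/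
def RapidDecayFamily (ω : ℝ → ℝ) (T : Rn N → Rn N → ℂ) : Prop :=
  (∀ a, IsSmooth (T a)) ∧ ∀ (k : ℕ) (l : ℝ), ∃ C μ : ℝ, ∀ a x,
    Real.exp (l * ω ‖x‖) * ‖iteratedFDeriv ℝ k (T a) x‖ ≤ C * Real.exp (μ * ω ‖a‖)

theorem RapidDecayFamily.rapidDecay {T : Rn N → Rn N → ℂ} (hT : RapidDecayFamily ω T)
    (a : Rn N) : RapidDecay ω (T a) :=
  ⟨hT.1 a, fun k l => by
    obtain ⟨C, μ, h⟩ := hT.2 k l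
    exact ⟨_, h a⟩⟩

theorem exists_exp_weight_mul_norm_iteratedFDeriv_gauss_le (hω : IsNonquasianalyticWeight ω)
    (k : ℕ) (l : ℝ) :
    ∃ C : ℝ, ∀ x : Rn N, Real.exp (l * ω ‖x‖) * ‖iteratedFDeriv ℝ k gauss x‖ ≤ C := by
  obtain ⟨A, hA, h⟩ := hω.exists_le_linear
  obtain ⟨C, hC⟩ := exists_exp_mul_norm_iteratedFDeriv_gauss_le (N := N) k (|l| * A)
  refine ⟨Real.exp (|l| * A) * C, fun x => ?_⟩
  have h1 : l * ω ‖x‖ ≤ |l| * A + |l| * A * ‖x‖ := by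
    have h2 := h _ (norm_nonneg x)
    have h3 := hω.nonneg _ (norm_nonneg x)
    calc l * ω ‖x‖ ≤ |l| * ω ‖x‖ := by gcongr; exact le_abs_self l
      _ ≤ |l| * (A * (1 + ‖x‖)) := by gcongr
      _ = _ := by ring
  calc Real.exp (l * ω ‖x‖) * ‖iteratedFDeriv ℝ k gauss x‖
      ≤ Real.exp (|l| * A + |l| * A * ‖x‖) * ‖iteratedFDeriv ℝ k gauss x‖ := by gcongr
    _ = Real.exp (|l| * A) * (Real.exp (|l| * A * ‖x‖) * ‖iteratedFDeriv ℝ k gauss x‖) := by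
      rw [Real.exp_add, mul_assoc]
    _ ≤ _ := by gcongr; exact hC x

theorem rapidDecayFamily_translate (hω : IsNonquasianalyticWeight ω) :
    RapidDecayFamily ω fun a x : Rn N => gauss (x - a) := by
  refine ⟨fun a => isSmooth_gauss.comp (contDiff_id.sub contDiff_const), fun k l => ?_⟩
  obtain ⟨K, hK, h⟩ := hω.exists_le_add N
  obtain ⟨C, hC⟩ := exists_exp_weight_mul_norm_iteratedFDeriv_gauss_le (N := N) hω k (|l| * K)
  refine ⟨Real.exp (|l| * K * 2) * C, |l| * K, fun a x => ?_⟩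
  rw [iteratedFDeriv_comp_sub]
  have h1 : l * ω ‖x‖ ≤ |l| * K * 2 + |l| * K * ω ‖a‖ + |l| * K * ω ‖x - a‖ := by
    have h3 := hω.nonneg _ (norm_nonneg x)
    calc l * ω ‖x‖ ≤ |l| * ω ‖x‖ := by gcongr; exact le_abs_self l
      _ ≤ |l| * (K * (2 + ω ‖x - a‖ + ω ‖a‖)) := by gcongr; exact h x a
      _ = _ := by ring
  calc Real.exp (l * ω ‖x‖) * ‖iteratedFDeriv ℝ k gauss (x - a)‖
      ≤ Real.exp (|l| * K * 2 + |l| * K * ω ‖a‖ + |l| * K * ω ‖x - a‖) *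
        ‖iteratedFDeriv ℝ k gauss (x - a)‖ := by gcongr
    _ = Real.exp (|l| * K * 2) * (Real.exp (|l| * K * ω ‖x - a‖) *
        ‖iteratedFDeriv ℝ k gauss (x - a)‖) * Real.exp (|l| * K * ω ‖a‖) := by
      rw [Real.exp_add, Real.exp_add]; ring
    _ ≤ _ := by gcongr; exact hC (x - a)

theorem rapidDecayFamily_modulate (hω : IsNonquasianalyticWeight ω) :
    RapidDecayFamily ω fun a x : Rn N => character a x * gauss x := by
  refine ⟨fun a => (isSmooth_character a).mul isSmooth_gauss, fun k l => ?_⟩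
  obtain ⟨B, hB, h⟩ := hω.exists_one_add_le_exp
  choose C hC using fun n =>
    exists_exp_weight_mul_norm_iteratedFDeriv_gauss_le (N := N) hω n l
  have hC0 : ∀ n, 0 ≤ C n := fun n => le_trans (by positivity) (hC n 0)
  refine ⟨(∑ i ∈ Finset.range (k + 1), (k.choose i : ℝ) * C (k - i)) * Real.exp (B * k),
    B * k, fun a x => ?_⟩
  have h1 : (1 + ‖a‖) ^ k ≤ Real.exp (B * k) * Real.exp (B * k * ω ‖a‖) := by
    calc (1 + ‖a‖) ^ k ≤ (Real.exp (B * (1 + ω ‖a‖))) ^ k := by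
          gcongr; exact h _ (norm_nonneg a)
      _ = _ := by rw [← Real.exp_nat_mul, ← Real.exp_add]; congr 1; ring
  have h2 : ‖iteratedFDeriv ℝ k (fun x => character a x * gauss x) x‖ ≤
      ∑ i ∈ Finset.range (k + 1), (k.choose i : ℝ) * ‖iteratedFDeriv ℝ i (character a) x‖ *
        ‖iteratedFDeriv ℝ (k - i) gauss x‖ :=
    norm_iteratedFDeriv_mul_le (isSmooth_character a) isSmooth_gauss x
      (by exact_mod_cast le_top)
  calc Real.exp (l * ω ‖x‖) * ‖iteratedFDeriv ℝ k (fun x => character a x * gauss x) x‖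
      ≤ Real.exp (l * ω ‖x‖) * ∑ i ∈ Finset.range (k + 1),
        (k.choose i : ℝ) * ‖iteratedFDeriv ℝ i (character a) x‖ *
          ‖iteratedFDeriv ℝ (k - i) gauss x‖ := by gcongr
    _ ≤ (∑ i ∈ Finset.range (k + 1), (k.choose i : ℝ) * C (k - i)) * (1 + ‖a‖) ^ k := by
      rw [Finset.mul_sum, Finset.sum_mul]
      refine Finset.sum_le_sum fun i hi => ?_
      have hik : i ≤ k := Nat.lt_succ_iff.1 (Finset.mem_range.1 hi)
      have h3 : ‖iteratedFDeriv ℝ i (character a) x‖ ≤ (1 + ‖a‖) ^ k :=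
        calc _ ≤ ‖a‖ ^ i := norm_iteratedFDeriv_character_le a x i
          _ ≤ (1 + ‖a‖) ^ i := by gcongr; linarith
          _ ≤ _ := pow_le_pow_right₀ (by linarith [norm_nonneg a]) hik
      calc _ = (k.choose i : ℝ) * (Real.exp (l * ω ‖x‖) * ‖iteratedFDeriv ℝ (k - i) gauss x‖) *
            ‖iteratedFDeriv ℝ i (character a) x‖ := by ring
        _ ≤ _ := by
          have := hC (k - i) x
          have := hC0 (k - i)
          gcongr
    _ ≤ (∑ i ∈ Finset.range (k + 1), (k.choose i : ℝ) * C (k - i)) *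
        (Real.exp (B * k) * Real.exp (B * k * ω ‖a‖)) := by
      have : 0 ≤ ∑ i ∈ Finset.range (k + 1), (k.choose i : ℝ) * C (k - i) :=
        Finset.sum_nonneg fun i _ => mul_nonneg (by positivity) (hC0 _)
      gcongr
    _ = _ := by ring

theorem summable_exp_weight (ω : ℝ → ℝ) {a : ℕ → Rn N} (ha : ∀ j, 1 ≤ ω ‖a j‖) (μ : ℝ) :
    Summable fun j : ℕ => Real.exp (-(j * ω ‖a j‖)) * Real.exp (μ * ω ‖a j‖) := by
  have hs : Summable fun j : ℕ => Real.exp μ * Real.exp (-(j : ℝ)) :=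
    Real.summable_exp_neg_nat.mul_left _
  refine Summable.of_norm_bounded_eventually_nat hs ?_
  filter_upwards [Filter.eventually_ge_atTop ⌈μ⌉₊] with j hj
  have hj' : μ ≤ j := (Nat.le_ceil μ).trans (by exact_mod_cast hj)
  rw [Real.norm_of_nonneg (by positivity), ← Real.exp_add, ← Real.exp_add]
  refine Real.exp_le_exp.2 ?_
  nlinarith [ha j]

/-- The series `∑ exp (-j ω(a_j)) T_{a_j}`. -/
noncomputable def weightedSeries (ω : ℝ → ℝ) (a : ℕ → Rn N) (T : Rn N → Rn N → ℂ)
    (x : Rn N) : ℂ :=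
  ∑' j : ℕ, ((Real.exp (-(j * ω ‖a j‖)) : ℝ) : ℂ) * T (a j) x

theorem RapidDecayFamily.term_bound {T : Rn N → Rn N → ℂ} (hT : RapidDecayFamily ω T)
    {a : ℕ → Rn N} (ha : ∀ j, 1 ≤ ω ‖a j‖) (k : ℕ) (l : ℝ) :
    ∃ v : ℕ → ℝ, Summable v ∧ ∀ j x, Real.exp (l * ω ‖x‖) * ‖iteratedFDeriv ℝ k
      (fun x => ((Real.exp (-(j * ω ‖a j‖)) : ℝ) : ℂ) * T (a j) x) x‖ ≤ v j := by
  obtain ⟨C, μ, h⟩ := hT.2 k l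
  refine ⟨_, (summable_exp_weight ω ha μ).mul_left C, fun j x => ?_⟩
  rw [iteratedFDeriv_const_mul_of_isSmooth (hT.1 _), norm_smul, Complex.norm_real, Real.norm_of_nonneg (by positivity)]
  calc _ = Real.exp (-(j * ω ‖a j‖)) *
        (Real.exp (l * ω ‖x‖) * ‖iteratedFDeriv ℝ k (T (a j)) x‖) := by ring
    _ ≤ Real.exp (-(j * ω ‖a j‖)) * (C * Real.exp (μ * ω ‖a j‖)) :=
        mul_le_mul_of_nonneg_left (h _ _) (Real.exp_pos _).le
    _ = _ := by ring

theorem RapidDecayFamily.rapidDecay_weightedSeries {T : Rn N → Rn N → ℂ}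
    (hT : RapidDecayFamily ω T) {a : ℕ → Rn N} (ha : ∀ j, 1 ≤ ω ‖a j‖) :
    RapidDecay ω (weightedSeries ω a T) := by
  have hsm : ∀ j : ℕ, IsSmooth fun x => ((Real.exp (-(j * ω ‖a j‖)) : ℝ) : ℂ) * T (a j) x :=
    fun j => contDiff_const.mul (hT.1 _)
  choose v hv hb using fun k => hT.term_bound ha k 0
  simp only [zero_mul, Real.exp_zero, one_mul] at hb
  refine ⟨contDiff_tsum hsm (fun k _ => hv k) (fun k j x _ => hb k j x), fun k l => ?_⟩
  obtain ⟨u, hu, hub⟩ := hT.term_bound ha k l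
  refine ⟨∑' j, u j, fun x => ?_⟩
  have h1 : iteratedFDeriv ℝ k (weightedSeries ω a T) x = ∑' j : ℕ, iteratedFDeriv ℝ k
      (fun x => ((Real.exp (-(j * ω ‖a j‖)) : ℝ) : ℂ) * T (a j) x) x :=
    iteratedFDeriv_tsum_apply hsm (fun k _ => hv k) (fun k j x _ => hb k j x) (by exact_mod_cast le_top) x
  have hs : Summable fun j : ℕ => ‖iteratedFDeriv ℝ k
      (fun x => ((Real.exp (-(j * ω ‖a j‖)) : ℝ) : ℂ) * T (a j) x) x‖ :=
    Summable.of_nonneg_of_le (fun _ => norm_nonneg _) (fun j => hb k j x) (hv k)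
  rw [h1]
  calc _ ≤ Real.exp (l * ω ‖x‖) * ∑' j : ℕ, ‖iteratedFDeriv ℝ k
        (fun x => ((Real.exp (-(j * ω ‖a j‖)) : ℝ) : ℂ) * T (a j) x) x‖ := by
        gcongr; exact norm_tsum_le_tsum_norm hs
    _ ≤ _ := by
        rw [← tsum_mul_left]
        exact (hs.mul_left _).tsum_le_tsum (fun j => hub j x) hu

theorem summable_exp_neg_weight {a : ℕ → Rn N} (ha : ∀ j, 1 ≤ ω ‖a j‖) :
    Summable fun j : ℕ => Real.exp (-(j * ω ‖a j‖)) := by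
  simpa using summable_exp_weight ω ha 0

theorem fourierT_weightedSeries {a : ℕ → Rn N} (ha : ∀ j, 1 ≤ ω ‖a j‖) :
    fourierT (weightedSeries ω a fun a x => gauss (x - a)) =
      fun ξ => gaussFactor N * weightedSeries ω a (fun a x => character a x * gauss x) ξ := by
  funext ξ
  have hphase : ∀ x : Rn N, ‖Complex.exp (-(Complex.I * ((inner ℝ x ξ : ℝ) : ℂ)))‖ = 1 := by
    intro x
    rw [← mul_neg, mul_comm, ← Complex.ofReal_neg, Complex.norm_exp_ofReal_mul_I]
  set F : ℕ → Rn N → ℂ := fun j x => ((Real.exp (-(j * ω ‖a j‖)) : ℝ) : ℂ) *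
    (gauss (x - a j) * Complex.exp (-(Complex.I * ((inner ℝ x ξ : ℝ) : ℂ)))) with hF
  have hint : ∀ j, MeasureTheory.Integrable (F j) := by
    intro j
    refine MeasureTheory.Integrable.const_mul ?_ _
    refine (integrable_gauss.comp_sub_right (a j)).mul_bdd (c := 1) ?_ ?_
    · exact (Continuous.aestronglyMeasurable (by fun_prop))
    · exact Filter.Eventually.of_forall fun x => (hphase x).le
  have hsum : Summable fun j => ∫ x, ‖F j x‖ := by
    have : ∀ j, ∫ x, ‖F j x‖ = Real.exp (-(j * ω ‖a j‖)) * ∫ x : Rn N, ‖gauss x‖ := by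
      intro j
      simp_rw [hF, norm_mul, hphase, mul_one]
      rw [MeasureTheory.integral_const_mul, Complex.norm_real, Real.norm_of_nonneg (by positivity),
        MeasureTheory.integral_sub_right_eq_self (fun x : Rn N => ‖gauss x‖)]
    simp_rw [this]
    exact (summable_exp_neg_weight ha).mul_right _
  have h1 : ∀ x, weightedSeries ω a (fun a x => gauss (x - a)) x *
      Complex.exp (-(Complex.I * ((inner ℝ x ξ : ℝ) : ℂ))) = ∑' j, F j x := by
    intro x
    rw [weightedSeries, ← tsum_mul_right]
    exact tsum_congr fun j => by rw [hF]; ring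
  unfold fourierT
  simp_rw [h1]
  rw [← MeasureTheory.integral_tsum_of_summable_integral_norm hint hsum, weightedSeries,
    ← tsum_mul_left]
  refine tsum_congr fun j => ?_
  have h2 := congrFun (fourierT_gauss_sub (a j)) ξ
  rw [fourierT] at h2
  rw [hF, MeasureTheory.integral_const_mul, h2]
  ring

theorem gauss_mem_Sw (hω : IsNonquasianalyticWeight ω) : (gauss : Rn N → ℂ) ∈ Sw N ω := by
  have h := fourierT_gauss_sub (0 : Rn N)
  have h0 := (rapidDecayFamily_translate (N := N) hω).rapidDecay 0
  simp only [sub_zero] at h h0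
  refine mem_Sw_of_rapidDecay hω h0 ?_
  change RapidDecay ω (fourierT fun x => gauss x)
  rw [h]
  exact ((rapidDecayFamily_modulate hω).rapidDecay 0).const_mul _

theorem weightedSeries_mem_Sw (hω : IsNonquasianalyticWeight ω) {a : ℕ → Rn N}
    (ha : ∀ j, 1 ≤ ω ‖a j‖) : weightedSeries ω a (fun a x => gauss (x - a)) ∈ Sw N ω := by
  refine mem_Sw_of_rapidDecay hω ((rapidDecayFamily_translate hω).rapidDecay_weightedSeries ha) ?_
  rw [fourierT_weightedSeries ha]
  exact ((rapidDecayFamily_modulate hω).rapidDecay_weightedSeries ha).const_mul _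

theorem exp_neg_weight_le_norm_weightedSeries {a : ℕ → Rn N} (ha : ∀ j, 1 ≤ ω ‖a j‖) (j : ℕ) :
    Real.exp (-(j * ω ‖a j‖)) ≤ ‖weightedSeries ω a (fun a x => gauss (x - a)) (a j)‖ := by
  set t : ℕ → ℝ := fun i =>
    Real.exp (-(i * ω ‖a i‖)) * Real.exp (-(1 / 2) * ‖a j - a i‖ ^ 2) with ht
  have h1 : weightedSeries ω a (fun a x => gauss (x - a)) (a j) = ((∑' i, t i : ℝ) : ℂ) := by
    rw [weightedSeries, Complex.ofReal_tsum]
    exact tsum_congr fun i => by simp [ht, gauss]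
  have hs : Summable t := by
    refine Summable.of_nonneg_of_le (fun i => by positivity) (fun i => ?_)
      (summable_exp_neg_weight ha)
    refine mul_le_of_le_one_right (by positivity) (Real.exp_le_one_iff.2 ?_)
    nlinarith [sq_nonneg ‖a j - a i‖]
  rw [h1, Complex.norm_real]
  refine le_trans ?_ (le_abs_self _)
  refine le_trans ?_ (hs.le_tsum j fun i _ => by positivity)
  simp [ht]

/-- A function that becomes bounded after multiplication with any element of `S_ω` grows at most
like `exp (n ω)`. -/
theorem exists_growth_bound (hω : IsNonquasianalyticWeight ω) (F : Rn N → ℝ≥0∞)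
    (hF : ∀ g ∈ Sw N ω, ⨆ x, ‖g x‖ₑ * F x < ⊤) :
    ∃ n : ℕ+, ⨆ x, F x * ENNReal.ofReal (Real.exp (-((n : ℝ) * ω ‖x‖))) < ⊤ := by
  by_contra! hcon
  obtain ⟨B, hB, hlog⟩ := hω.exists_one_add_le_exp
  set R := Real.exp (B * 2)
  set M := (⨆ x, ‖(gauss : Rn N → ℂ) x‖ₑ * F x) / ENNReal.ofReal (Real.exp (-(1 / 2) * R ^ 2))
  have hM : M < ⊤ := ENNReal.div_lt_top (hF _ (gauss_mem_Sw hω)).ne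
    (by simp [Real.exp_pos])
  have hsmall : ∀ x : Rn N, ω ‖x‖ < 1 → F x ≤ M := by
    intro x hx
    have h1 : ‖x‖ ≤ R := by
      have := hlog _ (norm_nonneg x)
      calc ‖x‖ ≤ 1 + ‖x‖ := by linarith
        _ ≤ _ := this
        _ ≤ R := Real.exp_le_exp.2 (by gcongr; linarith)
    rw [ENNReal.le_div_iff_mul_le (Or.inl (by simp [Real.exp_pos])) (Or.inl ENNReal.ofReal_ne_top)]
    refine le_trans ?_ (le_iSup (fun x => ‖(gauss : Rn N → ℂ) x‖ₑ * F x) x)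
    rw [mul_comm]
    gcongr
    rw [gauss, ← ofReal_norm, Complex.norm_real, Real.norm_of_nonneg (by positivity)]
    gcongr ENNReal.ofReal (Real.exp ?_)
    nlinarith [norm_nonneg x]
  have hex : ∀ j : ℕ, ∃ x : Rn N, 1 ≤ ω ‖x‖ ∧
      (j : ℝ≥0∞) < F x * ENNReal.ofReal (Real.exp (-((j : ℝ) * ω ‖x‖))) := by
    intro j
    have h1 : max M j < ⨆ x : Rn N,
        F x * ENNReal.ofReal (Real.exp (-(((j + 1 : ℕ) : ℝ) * ω ‖x‖))) := by
      have := hcon ⟨j + 1, Nat.succ_pos j⟩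
      refine lt_of_lt_of_le ?_ this
      exact max_lt hM (ENNReal.natCast_lt_top j)
    obtain ⟨x, hx⟩ := lt_iSup_iff.1 h1
    have hx0 := hω.nonneg _ (norm_nonneg x)
    refine ⟨x, ?_, ?_⟩
    · by_contra! h
      refine absurd (((le_max_left _ _).trans_lt hx).trans_le ?_) (lt_irrefl M)
      refine (mul_le_of_le_one_right' ?_).trans (hsmall x h)
      rw [ENNReal.ofReal_le_one, Real.exp_le_one_iff]
      have : 0 ≤ ((j + 1 : ℕ) : ℝ) * ω ‖x‖ := by positivity
      linarith
    · refine ((le_max_right _ _).trans_lt hx).trans_le ?_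
      gcongr
      simp
  choose a ha hbig using hex
  have hfin := hF _ (weightedSeries_mem_Sw hω ha)
  obtain ⟨j, hj⟩ := ENNReal.exists_nat_gt hfin.ne
  refine absurd (hj.trans ((hbig j).trans_le ?_)) (lt_irrefl _)
  refine le_trans ?_ (le_iSup (fun x => ‖weightedSeries ω a (fun a x => gauss (x - a)) x‖ₑ * F x)
    (a j))
  rw [mul_comm, ← ofReal_norm]
  gcongr
  exact exp_neg_weight_le_norm_weightedSeries ha j

/-- The continuous linear map sending the gradient to the derivative. -/
noncomputable def ofGradient (N : ℕ) : (Fin N → ℂ) →L[ℝ] (Rn N →L[ℝ] ℂ) :=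
  ∑ i, (ContinuousLinearMap.smulRightL ℝ (Rn N) ℂ (EuclideanSpace.proj i)).comp
    (ContinuousLinearMap.proj i)

theorem ofGradient_apply (v : Fin N → ℂ) :
    ofGradient N v = ∑ i, (EuclideanSpace.proj i : Rn N →L[ℝ] ℝ).smulRight (v i) := by
  simp [ofGradient, sum_apply]

theorem hasFDerivAt_mderiv (α : Fin N → ℕ) {f : Rn N → ℂ} (hf : IsSmooth f) (x : Rn N) :
    HasFDerivAt (mderiv α f) (ofGradient N fun i => mderiv (α + Pi.single i 1) f x) x := by
  rw [ofGradient_apply, ← fderiv_mderiv α hf]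
  exact (IsSmooth.differentiableAt (contDiff_mderiv α hf) x).hasFDerivAt

open Filter Topology in
/-- A filter of smooth functions all of whose derivatives are uniformly Cauchy on balls converges,
together with all derivatives, to a smooth function. -/
theorem exists_smooth_limit {ι : Type*} {l : Filter ι} [l.NeBot] {u : ι → Rn N → ℂ}
    (hu : ∀ i, IsSmooth (u i))
    (hC : ∀ (α : Fin N → ℕ) (R ε : ℝ), 0 < ε → ∃ A ∈ l, ∀ i ∈ A, ∀ j ∈ A, ∀ x, ‖x‖ ≤ R →
      ‖mderiv α (u i) x - mderiv α (u j) x‖ ≤ ε) :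
    ∃ h : Rn N → ℂ, IsSmooth h ∧
      ∀ α x, Tendsto (fun i => mderiv α (u i) x) l (𝓝 (mderiv α h x)) := by
  have hlim : ∀ α x, ∃ c, Tendsto (fun i => mderiv α (u i) x) l (𝓝 c) := by
    intro α x
    refine cauchy_map_iff_exists_tendsto.1 (Metric.cauchy_iff.2 ⟨inferInstance, fun ε hε => ?_⟩)
    obtain ⟨A, hA, h⟩ := hC α ‖x‖ (ε / 2) (half_pos hε)
    refine ⟨_, image_mem_map hA, ?_⟩
    rintro _ ⟨i, hi, rfl⟩ _ ⟨j, hj, rfl⟩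
    rw [dist_eq_norm]
    linarith [h i hi j hj x le_rfl]
  choose H hH using hlim
  have hunif : ∀ (α : Fin N → ℕ) (R ε : ℝ), 0 < ε →
      ∀ᶠ i in l, ∀ x, ‖x‖ ≤ R → ‖H α x - mderiv α (u i) x‖ ≤ ε := by
    intro α R ε hε
    obtain ⟨A, hA, h⟩ := hC α R ε hε
    filter_upwards [hA] with i hi x hx
    refine le_of_tendsto ((hH α x).sub_const _).norm ?_
    filter_upwards [hA] with j hj using h j hj i hi x hx
  have hder : ∀ α x, HasFDerivAt (H α) (ofGradient N fun i => H (α + Pi.single i 1) x) x := by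
    intro α x
    refine hasFDerivAt_of_tendstoUniformlyOn (l := l) (s := Metric.ball 0 (‖x‖ + 1)) (x := x)
      (f := fun i => mderiv α (u i))
      (f' := fun i x => ofGradient N fun k => mderiv (α + Pi.single k 1) (u i) x)
      (g' := fun x => ofGradient N fun k => H (α + Pi.single k 1) x)
      Metric.isOpen_ball ?_ (fun i y _ => hasFDerivAt_mderiv α (hu i) y)
      (fun y _ => hH α y) (by simp)
    refine (ofGradient N).uniformContinuous.comp_tendstoUniformlyOn
      (F := fun i x k => mderiv (α + Pi.single k 1) (u i) x)
      (f := fun x k => H (α + Pi.single k 1) x) ?_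
    rw [Metric.tendstoUniformlyOn_iff]
    intro ε hε
    filter_upwards [eventually_all.2 fun k =>
      hunif (α + Pi.single k 1) (‖x‖ + 1) (ε / 2) (half_pos hε)] with i hi y hy
    refine lt_of_le_of_lt ((dist_pi_le_iff (half_pos hε).le).2 fun k => ?_) (half_lt_self hε)
    rw [dist_eq_norm]
    exact hi k y (mem_ball_zero_iff.1 hy).le
  have hsmooth : ∀ (n : ℕ) α, ContDiff ℝ n (H α) := by
    intro n
    induction n with
    | zero =>
      intro α
      exact contDiff_zero.2 (continuous_iff_continuousAt.2 fun x => (hder α x).continuousAt)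
    | succ n ih =>
      intro α
      refine contDiff_succ_iff_hasFDerivAt.2 ⟨_, ?_, hder α⟩
      exact (ofGradient N).contDiff.comp (contDiff_pi.2 fun i => ih _)
  have hs : ∀ α, IsSmooth (H α) := fun α => contDiff_infty.2 fun n => hsmooth n α
  refine ⟨H 0, hs 0, fun α => ?_⟩
  suffices mderiv α (H 0) = H α by rw [this]; exact hH α
  induction α using multiIndex_induction with
  | zero => exact mderiv_zero _
  | add_single α i ih =>
    rw [← pderiv_mderiv i α (hs 0), ih, pderiv_eq_fderiv i (hs α)]
    funext x
    rw [(hder α x).fderiv, ofGradient_apply]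
    simp only [sum_apply, ContinuousLinearMap.smulRight_apply, PiLp.proj_apply]
    rw [Finset.sum_eq_single_of_mem i (Finset.mem_univ i) (fun k _ hk => by simp [hk])]
    simp

variable {m : ℕ}

theorem youngWeight_ne_top (ω : ℝ → ℝ) (hm : 0 < m) (k : ℕ) : youngWeight ω m k ≠ ⊤ := by
  have h1 : ((-ω 1 : ℝ) : EReal) ≤ youngConj ω ((k : ℝ) / m) := by
    refine le_trans ?_ (le_iSup _ ⟨0, le_rfl⟩)
    simp
  have h2 : youngConj ω ((k : ℝ) / m) ≠ ⊥ := fun h => by simp [h] at h1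
  have hm' : (0 : ℝ) < m := by exact_mod_cast hm
  rw [youngWeight, Ne, EReal.exp_eq_top_iff, EReal.neg_eq_top_iff]
  induction hc : youngConj ω ((k : ℝ) / m) with
  | bot => exact absurd hc h2
  | coe c => rw [← EReal.coe_mul]; exact EReal.coe_ne_bot _
  | top => rw [EReal.coe_mul_top_of_pos hm']; simp

theorem youngWeight_ne_zero (hm : 0 < m) {k : ℕ} (h : youngConj ω ((k : ℝ) / m) < ⊤) :
    youngWeight ω m k ≠ 0 := by
  have hm' : (0 : ℝ) < m := by exact_mod_cast hm
  rw [youngWeight, Ne, EReal.exp_eq_zero_iff, EReal.neg_eq_bot_iff]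
  induction hc : youngConj ω ((k : ℝ) / m) with
  | bot => rw [EReal.coe_mul_bot_of_pos hm']; simp
  | coe c => rw [← EReal.coe_mul]; exact EReal.coe_ne_top _
  | top => simp [hc] at h

theorem youngConj_zero_lt_top (hω : IsNonquasianalyticWeight ω) : youngConj ω 0 < ⊤ := by
  refine lt_of_le_of_lt (iSup_le fun t => ?_) (EReal.coe_lt_top 0)
  have := hω.nonneg (Real.exp t) (Real.exp_pos _).le
  rw [zero_mul, zero_sub]
  exact_mod_cast neg_nonpos.2 this

theorem exists_q_le_mul_r {g : Rn N → ℂ} (hg : g ∈ Sw N ω) (m : ℕ) (n : ℕ+) :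
    ∃ C : ℝ, 0 < C ∧ ∀ f, q ω m g f ≤ ENNReal.ofReal C * r ω m n f := by
  obtain ⟨⟨C, hC⟩, -⟩ := hg.2.2.2 n 0 (by exact_mod_cast n.pos)
  simp only [mderiv_zero] at hC
  refine ⟨max C 1, by positivity, fun f => iSup₂_le fun α x => ?_⟩
  have h1 : ‖g x‖ₑ ≤ ENNReal.ofReal (max C 1) * ENNReal.ofReal (Real.exp (-((n : ℝ) * ω ‖x‖))) := by
    rw [← ENNReal.ofReal_mul (by positivity), ← ofReal_norm]
    refine ENNReal.ofReal_le_ofReal ?_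
    rw [Real.exp_neg, ← div_eq_mul_inv, le_div_iff₀ (Real.exp_pos _), mul_comm]
    exact (hC x).trans (le_max_left _ _)
  calc ‖mderiv α f x‖ₑ * (‖g x‖ₑ * youngWeight ω m (len α))
      ≤ ‖mderiv α f x‖ₑ * (ENNReal.ofReal (max C 1) *
        ENNReal.ofReal (Real.exp (-((n : ℝ) * ω ‖x‖))) * youngWeight ω m (len α)) := by gcongr
    _ = ENNReal.ofReal (max C 1) * (‖mderiv α f x‖ₑ *
        (ENNReal.ofReal (Real.exp (-((n : ℝ) * ω ‖x‖))) * youngWeight ω m (len α))) := by ring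
    _ ≤ _ := by
      gcongr
      exact le_iSup₂ (f := fun α x => ‖mderiv α f x‖ₑ *
        (ENNReal.ofReal (Real.exp (-((n : ℝ) * ω ‖x‖))) * youngWeight ω m (len α))) α x

theorem unionSubmodule_le_sSubmodule (hω : IsNonquasianalyticWeight ω) (m : ℕ) :
    unionSubmodule N ω hω m ≤ sSubmodule N ω m := by
  intro f hf
  obtain ⟨n, hn⟩ := Set.mem_iUnion.1 hf
  refine ⟨hn.1, fun g hg => ?_⟩
  obtain ⟨C, -, hC⟩ := exists_q_le_mul_r hg m n
  exact (hC f).trans_lt (ENNReal.mul_lt_top ENNReal.ofReal_lt_top hn.2)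

/-- Families of functions on which every `q_{m,g}` is bounded are bounded in a single step. -/
theorem exists_r_bound (hω : IsNonquasianalyticWeight ω) (m : ℕ) (B : Set (Rn N → ℂ))
    (hB : ∀ g ∈ Sw N ω, ⨆ f ∈ B, q ω m g f < ⊤) : ∃ n : ℕ+, ⨆ f ∈ B, r ω m n f < ⊤ := by
  set F : Rn N → ℝ≥0∞ := fun x => ⨆ f ∈ B, ⨆ α, ‖mderiv α f x‖ₑ * youngWeight ω m (len α) with hF
  obtain ⟨n, hn⟩ := exists_growth_bound hω F fun g hg => by
    refine lt_of_le_of_lt (iSup_le fun x => ?_) (hB g hg)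
    simp only [hF, ENNReal.mul_iSup]
    refine iSup₂_mono fun f _ => iSup_le fun α => ?_
    rw [mul_left_comm]
    exact le_iSup₂ (f := fun α x => ‖mderiv α f x‖ₑ * (‖g x‖ₑ * youngWeight ω m (len α))) α x
  refine ⟨n, lt_of_le_of_lt (iSup₂_le fun f hf => iSup₂_le fun α x => ?_) hn⟩
  refine le_trans ?_ (le_iSup _ x)
  dsimp only
  rw [mul_comm (ENNReal.ofReal _), ← mul_assoc]
  gcongr
  exact (le_iSup (fun α => ‖mderiv α f x‖ₑ * youngWeight ω m (len α)) α).trans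
    (le_iSup₂ (f := fun f (_ : f ∈ B) => ⨆ α, ‖mderiv α f x‖ₑ * youngWeight ω m (len α)) f hf)

theorem sSubmodule_le_unionSubmodule (hω : IsNonquasianalyticWeight ω) (m : ℕ) :
    sSubmodule N ω m ≤ unionSubmodule N ω hω m := by
  intro f hf
  obtain ⟨n, hn⟩ := exists_r_bound hω m {f} (by simpa using hf.2)
  exact Set.mem_iUnion.2 ⟨n, hf.1, by simpa using hn⟩

theorem unionSubmodule_eq_sSubmodule (hω : IsNonquasianalyticWeight ω) (m : ℕ) :
    unionSubmodule N ω hω m = sSubmodule N ω m :=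
  le_antisymm (unionSubmodule_le_sSubmodule hω m) (sSubmodule_le_unionSubmodule hω m)

/-- The inclusion of the union of the steps into `O^m_{s_ω}`. -/
noncomputable def unionInclusion (hω : IsNonquasianalyticWeight ω) (m : ℕ) :
    UnionO N ω hω m →ₗ[ℂ] SpaceO N ω m :=
  Submodule.inclusion (unionSubmodule_le_sSubmodule hω m)

theorem hasBasis_nhds_stepTopology (N : ℕ) (ω : ℝ → ℝ) (m n : ℕ) (f : stepSubmodule N ω m n) :
    (@nhds _ (stepTopology N ω m n) f).HasBasis (fun δ : ℝ => 0 < δ) fun δ =>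
      {h | (r ω m n ((h - f : stepSubmodule N ω m n) : Rn N → ℂ)).toReal < δ} := by
  let E : SeminormedAddCommGroup (stepSubmodule N ω m n) :=
    (wseminorm (stepSubmodule N ω m n) _ (fun _ hf => hf)).toSeminormedAddCommGroup
  refine (@Metric.nhds_basis_ball _ E.toPseudoMetricSpace f).congr (fun _ => Iff.rfl)
    fun δ _ => Set.ext fun h => ?_
  rw [@Metric.mem_ball _ E.toPseudoMetricSpace, @dist_eq_norm _ E]
  rfl

open Topology in
theorem continuous_unionInclusion_comp_stepInclusion (hω : IsNonquasianalyticWeight ω) (m : ℕ)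
    (n : ℕ+) : @Continuous _ _ (stepTopology N ω m n) _
      (unionInclusion hω m ∘ stepInclusion N ω hω m n) := by
  let := stepTopology N ω m n
  refine continuous_iff_continuousAt.2 fun f => ?_
  refine ((withSeminorms_qFamily N ω m).tendsto_nhds _ _).2 fun g ε hε => ?_
  obtain ⟨C, hC0, hC⟩ := exists_q_le_mul_r g.2 m n
  filter_upwards [(hasBasis_nhds_stepTopology N ω m n f).mem_of_mem (div_pos hε hC0)]
    with h (h1 : (r ω m n ((h - f : stepSubmodule N ω m n) : Rn N → ℂ)).toReal < ε / C)
  have h2 : (q ω m g ((h - f : stepSubmodule N ω m n) : Rn N → ℂ)).toReal ≤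
      C * (r ω m n ((h - f : stepSubmodule N ω m n) : Rn N → ℂ)).toReal := by
    have := ENNReal.toReal_mono (ENNReal.mul_lt_top ENNReal.ofReal_lt_top (h - f).2.2).ne
      (hC ((h - f : stepSubmodule N ω m n) : Rn N → ℂ))
    rwa [ENNReal.toReal_mul, ENNReal.toReal_ofReal hC0.le] at this
  rw [lt_div_iff₀ hC0, mul_comm] at h1
  exact h2.trans_lt h1

instance : LocallyConvexSpace ℝ (SpaceO N ω m) :=
  (withSeminorms_qFamily N ω m).toLocallyConvexSpace

instance : ContinuousSMul ℂ (SpaceO N ω m) := (withSeminorms_qFamily N ω m).continuousSMul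

theorem continuous_unionInclusion (hω : IsNonquasianalyticWeight ω) (m : ℕ) :
    Continuous (unionInclusion (N := N) hω m) := by
  refine continuous_iff_le_induced.2 (sInf_le ⟨fun n => continuous_induced_rng.2
    (continuous_unionInclusion_comp_stepInclusion hω m n), ?_, ?_, ?_⟩)
  · exact topologicalAddGroup_induced (unionInclusion hω m)
  · exact continuousSMul_induced (unionInclusion hω m)
  · exact LocallyConvexSpace.induced ((unionInclusion hω m).restrictScalars ℝ)

theorem continuous_stepInclusion (hω : IsNonquasianalyticWeight ω) (m : ℕ) (n : ℕ+) :
    @Continuous _ _ (stepTopology N ω m n) _ (stepInclusion N ω hω m n) :=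
  continuous_sInf_rng.2 fun _ ht => ht.1 n

open Topology Pointwise in
theorem isVonNBounded_stepInclusion (hω : IsNonquasianalyticWeight ω) (m : ℕ) (n : ℕ+) (C : ℝ) :
    Bornology.IsVonNBounded ℂ
      (stepInclusion N ω hω m n '' {f | (r ω m n (f : Rn N → ℂ)).toReal ≤ C}) := by
  intro V hV
  have hpre : stepInclusion N ω hω m n ⁻¹' V ∈ @nhds _ (stepTopology N ω m n) 0 :=
    @ContinuousAt.preimage_mem_nhds _ _ (stepTopology N ω m n) _ _ _ _
      (@Continuous.continuousAt _ _ (stepTopology N ω m n) _ _ _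
        (continuous_stepInclusion hω m n)) hV
  obtain ⟨δ, hδ, hball⟩ := (hasBasis_nhds_stepTopology N ω m n 0).mem_iff.1 hpre
  have hlarge : ∀ᶠ c : ℂ in Bornology.cobounded ℂ, max C 0 / δ < ‖c‖ :=
    tendsto_norm_cobounded_atTop.eventually_gt_atTop _
  refine hlarge.mono fun c hc => ?_
  rintro _ ⟨f, hf, rfl⟩
  have hc0 : 0 < ‖c‖ := lt_of_le_of_lt (by positivity) hc
  refine ⟨stepInclusion N ω hω m n (c⁻¹ • f), hball ?_, ?_⟩
  · have h1 : (r ω m n ((c⁻¹ • f : stepSubmodule N ω m n) : Rn N → ℂ)).toReal =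
        ‖c‖⁻¹ * (r ω m n (f : Rn N → ℂ)).toReal := by
      rw [← norm_inv]
      exact map_smul_eq_mul (wseminorm (stepSubmodule N ω m n) _ (fun _ hf => hf)) c⁻¹ f
    rw [Set.mem_ofPred_eq, sub_zero, h1, inv_mul_lt_iff₀ hc0, ← div_lt_iff₀ hδ]
    refine lt_of_le_of_lt ?_ hc
    gcongr
    exact le_max_of_le_left hf
  · have h2 : stepInclusion N ω hω m n (c⁻¹ • f) = c⁻¹ • stepInclusion N ω hω m n f := rfl
    exact (congrArg (c • ·) h2).trans (smul_inv_smul₀ (norm_pos_iff.1 hc0) _)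

theorem isVonNBounded_iff (hω : IsNonquasianalyticWeight ω) (m : ℕ) (B : Set (Rn N → ℂ)) :
    (B ⊆ Set.range (UnionO.toFun : UnionO N ω hω m → Rn N → ℂ) ∧
        Bornology.IsVonNBounded ℂ ((UnionO.toFun : UnionO N ω hω m → Rn N → ℂ) ⁻¹' B)) ↔
      (B ⊆ Set.range (SpaceO.toFun : SpaceO N ω m → Rn N → ℂ) ∧
        Bornology.IsVonNBounded ℂ ((SpaceO.toFun : SpaceO N ω m → Rn N → ℂ) ⁻¹' B)) := by
  have hr1 : Set.range (UnionO.toFun : UnionO N ω hω m → Rn N → ℂ) =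
      (unionSubmodule N ω hω m : Set (Rn N → ℂ)) := Subtype.range_coe
  have hr2 : Set.range (SpaceO.toFun : SpaceO N ω m → Rn N → ℂ) =
      (sSubmodule N ω m : Set (Rn N → ℂ)) := Subtype.range_coe
  rw [hr1, hr2, unionSubmodule_eq_sSubmodule hω m]
  refine and_congr_right fun hsub => ⟨fun h => ?_, fun h => ?_⟩
  · let ι : UnionO N ω hω m →L[ℂ] SpaceO N ω m :=
      ⟨unionInclusion hω m, continuous_unionInclusion hω m⟩
    refine (h.image ι).subset fun f hf => ?_
    exact ⟨⟨f.toFun, sSubmodule_le_unionSubmodule hω m f.2⟩, hf, rfl⟩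
  · rw [(withSeminorms_qFamily N ω m).isVonNBounded_iff_seminorm_bddAbove] at h
    obtain ⟨n, hn⟩ := exists_r_bound hω m B fun g hg => by
      obtain ⟨C, hC⟩ := h ⟨g, hg⟩
      refine lt_of_le_of_lt (iSup₂_le fun f hf => ?_) (ENNReal.ofReal_lt_top (r := C))
      rw [ENNReal.le_ofReal_iff_toReal_le ((hsub hf).2 g hg).ne]
      · exact hC ⟨⟨f, hsub hf⟩, hf, rfl⟩
      · exact ENNReal.toReal_nonneg.trans (hC ⟨⟨f, hsub hf⟩, hf, rfl⟩)
    have hle : ∀ f ∈ B, r ω m n f ≤ ⨆ f ∈ B, r ω m n f := fun f hf =>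
      le_iSup₂ (f := fun f (_ : f ∈ B) => r ω m n f) f hf
    refine (isVonNBounded_stepInclusion hω m n (⨆ f ∈ B, r ω m n f).toReal).subset fun f hf => ?_
    exact ⟨⟨f.toFun, (hsub hf).1, (hle _ hf).trans_lt hn⟩,
      ENNReal.toReal_mono hn.ne (hle _ hf), rfl⟩

theorem norm_mderiv_mul_le_qFamily (g : Sw N ω) (f : SpaceO N ω m) (α : Fin N → ℕ) (x : Rn N) :
    ‖mderiv α f.toFun x‖ * (‖(g : Rn N → ℂ) x‖ * (youngWeight ω m (len α)).toReal) ≤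
      qFamily N ω m g f := by
  have h := ENNReal.toReal_mono (f.2.2 g g.2).ne
    (le_iSup₂ (f := fun α x => ‖mderiv α f.toFun x‖ₑ *
      (‖(g : Rn N → ℂ) x‖ₑ * youngWeight ω m (len α))) α x)
  rwa [ENNReal.toReal_mul, ENNReal.toReal_mul, toReal_enorm, toReal_enorm] at h

theorem q_le_of_forall (hm : 0 < m) {g f : Rn N → ℂ} {C : ℝ} (h : ∀ α x, ‖mderiv α f x‖ *
      (‖g x‖ * (youngWeight ω m (len α)).toReal) ≤ C) : q ω m g f ≤ ENNReal.ofReal C := by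
  refine iSup₂_le fun α x => ?_
  have h1 := ENNReal.ofReal_le_ofReal (h α x)
  rwa [ENNReal.ofReal_mul (norm_nonneg _), ENNReal.ofReal_mul (norm_nonneg _), ofReal_norm,
    ofReal_norm, ENNReal.ofReal_toReal (youngWeight_ne_top ω hm _)] at h1

theorem gauss_pos_of_norm_le {x : Rn N} {R : ℝ} (hx : ‖x‖ ≤ R) :
    Real.exp (-(1 / 2) * R ^ 2) ≤ ‖(gauss : Rn N → ℂ) x‖ := by
  rw [gauss, Complex.norm_real, Real.norm_of_nonneg (Real.exp_pos _).le]
  refine Real.exp_le_exp.2 ?_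
  nlinarith [norm_nonneg x]

theorem toReal_youngWeight_pos (hm : 0 < m) {k : ℕ} (h : youngConj ω ((k : ℝ) / m) < ⊤) :
    0 < (youngWeight ω m k).toReal :=
  ENNReal.toReal_pos (youngWeight_ne_zero hm h) (youngWeight_ne_top ω hm k)

theorem t2Space_spaceO (hω : IsNonquasianalyticWeight ω) (hm : 0 < m) :
    T2Space (SpaceO N ω m) := by
  have : T1Space (SpaceO N ω m) := by
    refine (withSeminorms_qFamily N ω m).T1_of_separating fun f hf => ?_
    by_contra! hzero
    refine hf (Subtype.ext (funext fun x => ?_))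
    have h1 := norm_mderiv_mul_le_qFamily ⟨gauss, gauss_mem_Sw hω⟩ f 0 x
    rw [hzero, mderiv_zero] at h1
    have h2 : 0 < ‖(gauss : Rn N → ℂ) x‖ * (youngWeight ω m (len (0 : Fin N → ℕ))).toReal :=
      mul_pos ((Real.exp_pos _).trans_le (gauss_pos_of_norm_le le_rfl))
        (toReal_youngWeight_pos hm (by simpa [len] using youngConj_zero_lt_top hω))
    exact norm_le_zero_iff.1 (nonpos_of_mul_nonpos_left h1 h2)
  infer_instance

open Filter Topology in
theorem completeSpace_spaceO (hω : IsNonquasianalyticWeight ω) (hm : 0 < m)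
    (hfin : ∀ s : ℝ, 0 ≤ s → youngConj ω s < ⊤) :
    @CompleteSpace (SpaceO N ω m) (IsTopologicalAddGroup.rightUniformSpace (SpaceO N ω m)) := by
  let := IsTopologicalAddGroup.rightUniformSpace (SpaceO N ω m)
  have : IsUniformAddGroup (SpaceO N ω m) := isUniformAddGroup_of_addCommGroup
  refine ⟨fun {l} hl => ?_⟩
  have : l.NeBot := hl.1
  have hC : ∀ (g : Sw N ω) (ε : ℝ), 0 < ε → ∃ A ∈ l, ∀ f ∈ A, ∀ f' ∈ A,
      qFamily N ω m g (f - f') ≤ ε := by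
    intro g ε hε
    have hV : {f | qFamily N ω m g f < ε} ∈ 𝓝 (0 : SpaceO N ω m) :=
      ((withSeminorms_qFamily N ω m).continuous_seminorm g).continuousAt.preimage_mem_nhds
        (Iio_mem_nhds (by rwa [map_zero]))
    have hU : {p : SpaceO N ω m × SpaceO N ω m | qFamily N ω m g (p.2 - p.1) < ε} ∈
        uniformity (SpaceO N ω m) := by
      rw [uniformity_eq_comap_nhds_zero]
      exact preimage_mem_comap hV
    obtain ⟨A, hA, h⟩ := (cauchy_iff.1 hl).2 _ hU
    exact ⟨A, hA, fun f hf f' hf' => (h (Set.mk_mem_prod hf' hf)).le⟩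
  have hsub : ∀ (f f' : SpaceO N ω m) α x, mderiv α (f - f').toFun x =
      mderiv α f.toFun x - mderiv α f'.toFun x := by
    intro f f' α x
    have h : (f - f').toFun = f.toFun + (-1 : ℂ) • f'.toFun := by
      rw [neg_one_smul, ← sub_eq_add_neg]; rfl
    have hs : IsSmooth f.toFun := f.2.1
    have hs' : IsSmooth f'.toFun := f'.2.1
    have hs'' : IsSmooth ((-1 : ℂ) • f'.toFun) := contDiff_const.smul hs'
    rw [h, mderiv_add α hs hs'', mderiv_smul α _ hs', neg_one_smul,
      ← sub_eq_add_neg]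
    rfl
  obtain ⟨h, hsm, hlim⟩ := exists_smooth_limit (l := l) (u := SpaceO.toFun) (fun f => f.2.1) (by
    intro α R ε hε
    set w := (youngWeight ω m (len α)).toReal
    have hw : 0 < w := toReal_youngWeight_pos hm (hfin _ (by positivity))
    obtain ⟨A, hA, hq⟩ := hC ⟨gauss, gauss_mem_Sw hω⟩
      (ε * (Real.exp (-(1 / 2) * R ^ 2) * w)) (by positivity)
    refine ⟨A, hA, fun f hf f' hf' x hx => ?_⟩
    have h1 := (norm_mderiv_mul_le_qFamily ⟨gauss, gauss_mem_Sw hω⟩ (f - f') α x).trans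
      (hq f hf f' hf')
    rw [hsub] at h1
    refine le_of_mul_le_mul_right (le_trans ?_ h1)
      (by positivity : 0 < Real.exp (-(1 / 2) * R ^ 2) * w)
    gcongr
    exact gauss_pos_of_norm_le hx)
  have hclose : ∀ (g : Sw N ω) (ε : ℝ), 0 < ε → ∃ A ∈ l, ∀ f ∈ A,
      ∀ α x, ‖mderiv α f.toFun x - mderiv α h x‖ *
        (‖(g : Rn N → ℂ) x‖ * (youngWeight ω m (len α)).toReal) ≤ ε := by
    intro g ε hε
    obtain ⟨A, hA, hq⟩ := hC g ε hε
    refine ⟨A, hA, fun f hf α x => ?_⟩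
    refine le_of_tendsto (((hlim α x).const_sub _).norm.mul_const _) ?_
    filter_upwards [hA] with f' hf'
    rw [← hsub]
    exact (norm_mderiv_mul_le_qFamily g (f - f') α x).trans (hq f hf f' hf')
  have hmem : h ∈ sSubmodule N ω m := by
    refine ⟨hsm, fun g hg => ?_⟩
    obtain ⟨A, hA, hq⟩ := hclose ⟨g, hg⟩ 1 one_pos
    obtain ⟨f, hf⟩ := nonempty_of_mem hA
    refine lt_of_le_of_lt (q_le_of_forall hm (C := 1 + qFamily N ω m ⟨g, hg⟩ f) fun α x => ?_)
      ENNReal.ofReal_lt_top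
    refine le_trans ?_ (add_le_add (hq f hf α x) (norm_mderiv_mul_le_qFamily ⟨g, hg⟩ f α x))
    rw [← add_mul, add_comm]
    gcongr
    simpa using norm_sub_le (mderiv α f.toFun x) (mderiv α f.toFun x - mderiv α h x)
  let h' : SpaceO N ω m := ⟨h, hmem⟩
  refine ⟨h', ?_⟩
  refine ((withSeminorms_qFamily N ω m).tendsto_nhds id _).2 fun g ε hε => ?_
  obtain ⟨A, hA, hq⟩ := hclose g (ε / 2) (half_pos hε)
  filter_upwards [hA] with f hf
  refine lt_of_le_of_lt ?_ (half_lt_self hε)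
  rw [qFamily_apply]
  refine ENNReal.toReal_le_of_le_ofReal (half_pos hε).le (q_le_of_forall hm fun α x => ?_)
  rw [id, hsub f h']
  exact hq f hf α x

end UltraMult

theorem proposition5p4 (N : ℕ) (ω : ℝ → ℝ) (hω : IsNonquasianalyticWeight ω)
    (m : ℕ) (hm : 0 < m) :
    -- the inclusion is well defined and continuous
    (∃ ι : UnionO N ω hω m →L[ℂ] SpaceO N ω m, ∀ f, (ι f).toFun = f.toFun) ∧
    -- the two spaces consist of the same functions and have the same bounded sets
    (⋃ n : ℕ+, {f : Rn N → ℂ | IsSmooth f ∧ r ω m n f < ⊤}) =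
      {f : Rn N → ℂ | IsSmooth f ∧ ∀ g ∈ Sw N ω, q ω m g f < ⊤} ∧
    (∀ B : Set (Rn N → ℂ),
      (B ⊆ Set.range (UnionO.toFun : UnionO N ω hω m → Rn N → ℂ) ∧
        Bornology.IsVonNBounded ℂ ((UnionO.toFun : UnionO N ω hω m → Rn N → ℂ) ⁻¹' B)) ↔
      (B ⊆ Set.range (SpaceO.toFun : SpaceO N ω m → Rn N → ℂ) ∧
        Bornology.IsVonNBounded ℂ ((SpaceO.toFun : SpaceO N ω m → Rn N → ℂ) ⁻¹' B))) ∧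
    -- `τ_m` is locally convex, Hausdorff, and complete as soon as `φ*` is real-valued
    LocallyConvexSpace ℝ (SpaceO N ω m) ∧ T2Space (SpaceO N ω m) ∧
    ((∀ s : ℝ, 0 ≤ s → youngConj ω s < ⊤) →
      @CompleteSpace (SpaceO N ω m) (IsTopologicalAddGroup.rightUniformSpace (SpaceO N ω m))) :=
  ⟨⟨⟨unionInclusion hω m, continuous_unionInclusion hω m⟩, fun _ => rfl⟩,
    congrArg (fun V : Submodule ℂ (Rn N → ℂ) => (V : Set (Rn N → ℂ)))
      (unionSubmodule_eq_sSubmodule hω m),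
    isVonNBounded_iff hω m, inferInstance, t2Space_spaceO hω hm, completeSpace_spaceO hω hm⟩
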